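/- Let $L$ be a positive definite even lattice (free abelian of finite rank) with form $\langle\cdot,\cdot\rangle$, and let $1\to\langle\pm1\rangle\to\hat L\xrightarrow{\,\bar{\ }\,}L\to 1$ be a central extension with commutator map $c(\alpha,\beta)=(-1)^{\langle\alpha,\beta\rangle}$. Put $\mathfrak h=\mathbb C\otimes_{\mathbb Z}L$ and let $V_L=M(1)\otimes\mathbb C\{L\}$ be the lattice vertex operator algebra, where $M(1)=S(\mathfrak h\otimes t^{-1}\mathbb C[t^{-1}])$ is the Heisenberg Fock space of level one, $\mathbb C\{L\}=\mathbb C[\hat L]\otimes_{\langle\pm1\rangle}\mathbb C$ (with $-1$ acting on $\mathbb C$ as $-1$), and $\iota(a)=1\otimes(a\otimes 1)$ for $a\in\hat L$. The vertex operators are the standard ones, determined by $Y(h(-1)\mathbf 1,z)=\sum_{n\in\mathbb Z}h(n)z^{-n-1}$ for $h\in\mathfrak h$ and $$Y(\iota(a),z)=\exp\Bigl(\sum_{n>0}\tfrac{\bar a(-n)}{n}z^{n}\Bigr)\exp\Bigl(-\sum_{n>0}\tfrac{\bar a(n)}{n}z^{-n}\Bigr)a\,z^{\bar a}\qquad(a\in\hat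 L),$$ and the Virasoro element is $\omega=\frac12\sum_i h_i(-1)^2\mathbf 1$ for an orthonormal basis $(h_i)$ of $\mathfrak h$; a vector $v$ has weight $n$ if $L(0)v=nv$, where $Y(\omega,z)=\sum_n L(n)z^{-n-2}$. Let $\theta$ be an automorphism of $\hat L$ with $\theta^2=1$ which induces $-1$ on $L$ (for example $\theta(a)=a^{-1}(-1)^{\langle\bar a,\bar a\rangle/2}$), and denote also by $\theta$ the induced automorphism of $V_L$, $h_1(-n_1)\cdots h_k(-n_k)\otimes\iota(a)\mapsto(-1)^k h_1(-n_1)\cdots h_k(-n_k)\otimes\iota(\theta a)$. Let $O_\theta(V_L)$ be the linear span of the vectors $$u\circ_\theta v=\operatorname{Res}_z\frac{(1+z)^{\operatorname{wt}u}}{z^{2}}Y(u,z)v\quad(\theta u=u),\qquad u\circ_\theta v=\operatorname{Res}_z\frac{(1+z)^{\operatorname{wt}u-\frac12}}{z}Y(u,z)v\quad(\theta u=-u),$$ where $u\in V_L$ is homogeneous, $v\in V_L$, and powers of $1+z$ are expanded in nonnegative powers of $z$; put $A_\theta(V_L)=V_L/O_\theta(V_L)$. Let $\alpha\mapsto e_\alpha$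 be any section $L\to\hat L$ and let $(\beta_i)_{i\in L/2L}$ be a system of representatives of the cosets of $2L$ in $L$. Then $A_\theta(V_L)$ is spanned by the classes $\iota(e_{\beta_i})+O_\theta(V_L)$, $i\in L/2L$. In particular $\dim A_\theta(V_L)\le|L/2L|$. -/

import Mathlib

open scoped TensorProduct

noncomputable section

/-! ### The twisted Zhu space of a vertex operator algebra -/

namespace TwistedZhu

variable {V : Type*} [AddCommGroup V] [Module ℂ V]

/-- `Res_z (1 + z)^s z^(-k) f(z)` for `f ∈ V((z))`, with `(1 + z)^s` expanded in nonnegative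
powers of `z`. -/
def residue (s : ℂ) (k : ℤ) (f : HahnModule ℤ ℂ V) : V :=
  ((HahnModule.of ℂ).symm
    ((HahnSeries.single (-k) (1 : ℂ) *
      HahnSeries.ofPowerSeries ℤ ℂ (PowerSeries.binomialSeries ℂ s)) • f)).coeff (-1)

/-- The weight space `V_n = {v | L(0) v = n v}`, where `L(0) = ω_1` is the coefficient of
`z^(-2)` in `Y(ω, z)`. -/
def weightSpace (Y : V →ₗ[ℂ] VertexOperator ℂ V) (ω : V) (n : ℤ) : Submodule ℂ V :=
  Module.End.eigenspace (VertexOperator.ncoeff (Y ω) 1) (n : ℂ)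

/-- The eigenspace `V^r = {v | g v = exp(-2πir/T) v}`. -/
def sector (g : V →ₗ[ℂ] V) (T r : ℕ) : Submodule ℂ V :=
  Module.End.eigenspace g (Complex.exp (-2 * Real.pi * Complex.I * r / T))

/-- `δ_r`, equal to `1` if `r = 0` and to `0` otherwise. -/
def delta (r : ℕ) : ℕ := if r = 0 then 1 else 0

/-- `u ∘_g v` for `u ∈ V^r` homogeneous of weight `n`. -/
def circ (Y : V →ₗ[ℂ] VertexOperator ℂ V) (T r : ℕ) (n : ℤ) (u v : V) : V :=
  residue ((n : ℂ) - 1 + delta r + (r : ℂ) / T) (1 + delta r) (Y u v)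

/-- `O_g(V)`, the linear span of all `u ∘_g v` with `u ∈ V^r` homogeneous, `0 ≤ r < T`,
and `v ∈ V`. -/
def O (Y : V →ₗ[ℂ] VertexOperator ℂ V) (ω : V) (g : V →ₗ[ℂ] V) (T : ℕ) : Submodule ℂ V :=
  Submodule.span ℂ {w | ∃ (r : ℕ) (n : ℤ) (u v : V), r < T ∧ u ∈ sector g T r ∧
    u ∈ weightSpace Y ω n ∧ w = circ Y T r n u v}

/-- `A_g(V) = V / O_g(V)`. -/
abbrev A (Y : V →ₗ[ℂ] VertexOperator ℂ V) (ω : V) (g : V →ₗ[ℂ] V) (T : ℕ) : Type _ :=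
  V ⧸ O Y ω g T

end TwistedZhu

/-- The action of `S((z))` on `V((z))` for an `S`-module `V`, `S` a commutative `ℂ`-algebra. -/
def seriesAction (S V : Type*) [CommRing S] [Algebra ℂ S] [AddCommGroup V] [Module ℂ V]
    [Module S V] [IsScalarTower ℂ S V] :
    HahnSeries ℤ S →+* Module.End ℂ (HahnModule ℤ ℂ V) where
  toFun f :=
    { toFun := fun x => HahnModule.of ℂ ((HahnModule.of S).symm
        (f • HahnModule.of S ((HahnModule.of ℂ).symm x)))
      map_add' := fun x y => by simp
      map_smul' := fun c x => by
        have h1 : HahnModule.of S ((HahnModule.of ℂ).symm (c • x)) =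
            algebraMap ℂ S c • HahnModule.of S ((HahnModule.of ℂ).symm x) := by
          refine HahnModule.ext _ _ (funext fun n => ?_)
          exact (algebraMap_smul S c (((HahnModule.of ℂ).symm x).coeff n)).symm
        have h2 : ∀ y : HahnModule ℤ S V,
            HahnModule.of ℂ ((HahnModule.of S).symm (algebraMap ℂ S c • y)) =
              c • HahnModule.of ℂ ((HahnModule.of S).symm y) := by
          intro y
          refine HahnModule.ext _ _ (funext fun n => ?_)
          exact algebraMap_smul S c (((HahnModule.of S).symm y).coeff n)
        rw [h1, ← smul_comm (algebraMap ℂ S c) f, h2, RingHom.id_apply] }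
  map_one' := by apply LinearMap.ext; intro x; simp
  map_mul' f g := by apply LinearMap.ext; intro x; simp [mul_smul]
  map_zero' := by apply LinearMap.ext; intro x; simp
  map_add' f g := by apply LinearMap.ext; intro x; simp [add_smul]

/-- The inclusion of `V` into `V((z))` as constant series. -/
def constSeries (V : Type*) [AddCommGroup V] [Module ℂ V] : V →ₗ[ℂ] HahnModule ℤ ℂ V where
  toFun v := HahnModule.of ℂ (HahnSeries.single 0 v)
  map_add' v w := by rw [HahnSeries.single_add, HahnModule.of_add]
  map_smul' c v := congrArg (HahnModule.of ℂ) (map_smul (HahnSeries.single.linearMap (0 : ℤ)) c v)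

theorem seriesAction_C (S V : Type*) [CommRing S] [Algebra ℂ S] [AddCommGroup V] [Module ℂ V]
    [Module S V] [IsScalarTower ℂ S V] (c : ℂ) :
    seriesAction S V (HahnSeries.C (algebraMap ℂ S c)) = c • 1 := by
  apply LinearMap.ext
  intro x
  refine HahnModule.ext _ _ (funext fun n => ?_)
  change ((HahnModule.of S).symm (HahnSeries.single (0 : ℤ) (algebraMap ℂ S c) •
    HahnModule.of S ((HahnModule.of ℂ).symm x))).coeff n = c • ((HahnModule.of ℂ).symm x).coeff n
  rw [HahnModule.coeff_single_zero_smul, algebraMap_smul, Equiv.symm_apply_apply]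

/-! ### Even lattices and their central extensions -/

/-- A positive definite even form on `L`; an even lattice is a free abelian group of finite rank
with such a form. -/
structure EvenLattice (L : Type*) [AddCommGroup L] where
  form : LinearMap.BilinForm ℤ L
  symm : ∀ x y, form x y = form y x
  even : ∀ x, Even (form x x)
  pos : ∀ x, x ≠ 0 → 0 < form x x

/-- A central extension `1 → ⟨±1⟩ → G → L → 1` with commutator map
`c(α, β) = (-1)^⟨α, β⟩`; the nontrivial element of the kernel is `neg`. -/
structure CentralExtension {L : Type*} [AddCommGroup L] (Λ : EvenLattice L)
    (G : Type*) [Group G] where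
  proj : G →* Multiplicative L
  surj : Function.Surjective proj
  neg : G
  neg_ne_one : neg ≠ 1
  neg_central : ∀ a, neg * a = a * neg
  ker : ∀ a, proj a = 1 ↔ a = 1 ∨ a = neg
  comm : ∀ a b, a * b * a⁻¹ * b⁻¹ = neg ^ Λ.form (proj a).toAdd (proj b).toAdd

namespace LatticeVOA

/-- `𝔥 = ℂ ⊗ L`. -/
abbrev Cartan (L : Type*) [AddCommGroup L] : Type _ := ℂ ⊗[ℤ] L

/-- `M(1) = S(𝔥 ⊗ t⁻¹ℂ[t⁻¹])`, where `Finsupp.single n h` stands for `h(-n-1) = h ⊗ t^(-n-1)`. -/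
def Fock (L : Type*) [AddCommGroup L] : Type _ := SymmetricAlgebra ℂ (ℕ →₀ Cartan L)

namespace Fock

variable {L : Type*} [AddCommGroup L]

instance : CommRing (Fock L) := inferInstanceAs (CommRing (SymmetricAlgebra ℂ (ℕ →₀ Cartan L)))

instance : Algebra ℂ (Fock L) :=
  inferInstanceAs (Algebra ℂ (SymmetricAlgebra ℂ (ℕ →₀ Cartan L)))

/-- The inclusion of `𝔥 ⊗ t⁻¹ℂ[t⁻¹]` into `M(1)`. -/
def gen : (ℕ →₀ Cartan L) →ₗ[ℂ] Fock L := SymmetricAlgebra.ι ℂ (ℕ →₀ Cartan L)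

/-- The algebra map out of `M(1)` into a possibly noncommutative algebra determined
by a linear map with pairwise commuting values. -/
def lift {A : Type*} [Semiring A] [Algebra ℂ A] (f : (ℕ →₀ Cartan L) →ₗ[ℂ] A)
    (hf : ∀ x y, f x * f y = f y * f x) : Fock L →ₐ[ℂ] A :=
  (RingCon.liftₐ _ (TensorAlgebra.lift ℂ f) (RingCon.ringConGen_le.2 (by
    rintro _ _ ⟨x, y⟩
    simpa [RingCon.ker_apply] using hf x y)) : SymmetricAlgebra ℂ (ℕ →₀ Cartan L) →ₐ[ℂ] A)

theorem lift_gen {A : Type*} [Semiring A] [Algebra ℂ A] (f : (ℕ →₀ Cartan L) →ₗ[ℂ] A)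
    (hf : ∀ x y, f x * f y = f y * f x) (x : ℕ →₀ Cartan L) : lift f hf (gen x) = f x :=
  TensorAlgebra.lift_ι_apply f x

theorem induction {motive : Fock L → Prop}
    (algebraMap : ∀ r, motive (algebraMap ℂ (Fock L) r)) (gen : ∀ x, motive (gen x))
    (mul : ∀ a b, motive a → motive b → motive (a * b))
    (add : ∀ a b, motive a → motive b → motive (a + b)) (a : Fock L) : motive a :=
  SymmetricAlgebra.induction ℂ (ℕ →₀ Cartan L) algebraMap gen mul add a

end Fock

section Heisenberg

variable {L : Type*} [AddCommGroup L] (Λ : EvenLattice L)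

/-- The `ℂ`-bilinear extension of the form to `𝔥`. -/
def cform : LinearMap.BilinForm ℂ (Cartan L) := Λ.form.baseChange ℂ

theorem exists_orthonormalBasis [Module.Free ℤ L] [Module.Finite ℤ L] :
    ∃ b : Module.Basis (Fin (Module.finrank ℂ (Cartan L))) ℂ (Cartan L),
      ∀ i j, cform Λ (b i) (b j) = if i = j then 1 else 0 := by
  have hnd : (cform Λ).SeparatingLeft := by
    let b := Module.Free.chooseBasis ℤ L
    have h1 : Λ.form.SeparatingLeft := by
      intro x hx
      by_contra h
      exact (Λ.pos x h).ne' (hx x)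
    have h2 := (LinearMap.separatingLeft_iff_det_ne_zero b).1 h1
    apply LinearMap.separatingLeft_of_det_ne_zero (b.baseChange ℂ)
    have h3 : LinearMap.toMatrix₂ (b.baseChange ℂ) (b.baseChange ℂ) (cform Λ) =
        (LinearMap.toMatrix₂ b b Λ.form).map (algebraMap ℤ ℂ) := by
      ext i j
      simp [LinearMap.toMatrix₂_apply, cform]
    rw [h3, ← RingHom.mapMatrix_apply, ← RingHom.map_det]
    simpa using h2
  have : Invertible (2 : ℂ) := invertibleOfNonzero two_ne_zero
  obtain ⟨v, hv⟩ := LinearMap.BilinForm.exists_orthogonal_basis (B := cform Λ)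
    (LinearMap.BilinForm.IsSymm.baseChange ℂ ⟨Λ.symm⟩)
  have hv0 := hv.not_isOrtho_basis_self_of_separatingLeft hnd
  choose c hc using fun i =>
    IsAlgClosed.exists_pow_nat_eq (cform Λ (v i) (v i)) (n := 2) (by norm_num)
  have hc0 : ∀ i, c i ≠ 0 := fun i h => hv0 i (by
    change cform Λ (v i) (v i) = 0
    rw [← hc i, h]; simp)
  refine ⟨v.isUnitSMul (w := fun i => (c i)⁻¹) (fun i => (inv_ne_zero (hc0 i)).isUnit),
    fun i j => ?_⟩
  simp only [Module.Basis.isUnitSMul_apply, map_smul, LinearMap.smul_apply, smul_eq_mul]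
  split_ifs with h
  · subst h
    rw [← hc i]; field_simp [hc0 i]
  · have : cform Λ (v i) (v j) = 0 := hv h
    simp [this]

/-- An orthonormal basis of `𝔥`. -/
def orthonormalBasis [Module.Free ℤ L] [Module.Finite ℤ L] :
    Module.Basis (Fin (Module.finrank ℂ (Cartan L))) ℂ (Cartan L) :=
  (exists_orthonormalBasis Λ).choose

/-- The element `h(-n-1)` of `M(1)`. -/
def creation (n : ℕ) : Cartan L →ₗ[ℂ] Fock L :=
  Fock.gen ∘ₗ Finsupp.lsingle n

/-- The linear map `𝔥 ⊗ t⁻¹ℂ[t⁻¹] → ⨁_{j ≥ 0} M(1)` sending `h(-m)` to the family whose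
entry at `j = m` is `m ⟨α, h⟩` and whose other entries are `0`. -/
def contract (α : Cartan L) : (ℕ →₀ Cartan L) →ₗ[ℂ] (ℕ →₀ Fock L) :=
  Finsupp.lsum ℂ fun m =>
    Finsupp.lsingle (m + 1) ∘ₗ Algebra.linearMap ℂ (Fock L) ∘ₗ (((m : ℂ) + 1) • cform Λ α)

/-- The derivation `Q ↦ (α(j) Q)_j` of `M(1)`, `j > 0` (the entry at `j = 0` is `0`); it is the
unique derivation of `S(𝔥 ⊗ t⁻¹ℂ[t⁻¹])` extending `contract`, obtained through the
square zero extension. -/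
def annihilationFock (α : Cartan L) : Fock L →ₗ[ℂ] (ℕ →₀ Fock L) :=
  (TrivSqZeroExt.sndHom (Fock L) (ℕ →₀ Fock L)).restrictScalars ℂ ∘ₗ
    (Fock.lift
      ((TrivSqZeroExt.inlAlgHom ℂ (Fock L) (ℕ →₀ Fock L)).toLinearMap ∘ₗ Fock.gen +
        (TrivSqZeroExt.inrHom (Fock L) (ℕ →₀ Fock L)).restrictScalars ℂ ∘ₗ
          contract Λ α) (fun _ _ => mul_comm _ _)).toLinearMap


theorem annihilationFock_gen (α : Cartan L) (x : ℕ →₀ Cartan L) :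
    annihilationFock Λ α (Fock.gen x) = contract Λ α x := by
  simp [annihilationFock, Fock.lift_gen]

theorem annihilationFock_algebraMap (α : Cartan L) (c : ℂ) :
    annihilationFock Λ α (algebraMap ℂ (Fock L) c) = 0 := by
  simp [annihilationFock, TrivSqZeroExt.algebraMap_eq_inl']

theorem annihilationFock_mul (α : Cartan L) (P Q : Fock L) :
    annihilationFock Λ α (P * Q) =
      P • annihilationFock Λ α Q + Q • annihilationFock Λ α P := by
  have h : ∀ R : Fock L, (Fock.lift
      ((TrivSqZeroExt.inlAlgHom ℂ (Fock L) (ℕ →₀ Fock L)).toLinearMap ∘ₗ Fock.gen +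
        (TrivSqZeroExt.inrHom (Fock L) (ℕ →₀ Fock L)).restrictScalars ℂ ∘ₗ
          contract Λ α) (fun _ _ => mul_comm _ _) R).fst = R := by
    intro R
    induction R using Fock.induction with
    | algebraMap r => simp [TrivSqZeroExt.algebraMap_eq_inl']
    | gen x => simp [Fock.lift_gen]
    | mul a b ha hb => simp [ha, hb]
    | add a b ha hb => simp [ha, hb]
  simp [annihilationFock, h]

theorem annihilationFock_comm (α β : Cartan L) (i j : ℕ) (Q : Fock L) :
    annihilationFock Λ α (annihilationFock Λ β Q j) i =
      annihilationFock Λ β (annihilationFock Λ α Q i) j := by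
  have hc : ∀ (γ : Cartan L) (k : ℕ) (x : ℕ →₀ Cartan L),
      ∃ c : ℂ, contract Λ γ x k = algebraMap ℂ (Fock L) c := by
    intro γ k x
    induction x using Finsupp.induction_linear with
    | zero => exact ⟨0, by simp⟩
    | add x y hx hy =>
      obtain ⟨c, hc⟩ := hx
      obtain ⟨d, hd⟩ := hy
      exact ⟨c + d, by simp [hc, hd]⟩
    | single n h =>
      by_cases hk : n + 1 = k
      · exact ⟨((n : ℂ) + 1) * cform Λ γ h, by simp [contract, hk]⟩
      · exact ⟨0, by simp [contract, hk]⟩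
  induction Q using Fock.induction with
  | algebraMap r => simp [annihilationFock_algebraMap]
  | gen x =>
    obtain ⟨c, h1⟩ := hc β j x
    obtain ⟨d, h2⟩ := hc α i x
    simp [annihilationFock_gen, h1, h2, annihilationFock_algebraMap]
  | mul a b ha hb =>
    simp [annihilationFock_mul, ha, hb]
    ring
  | add a b ha hb => simp [ha, hb]

theorem annihilationFock_add (α β : Cartan L) :
    annihilationFock Λ (α + β) = annihilationFock Λ α + annihilationFock Λ β := by
  have hc : ∀ x, contract Λ (α + β) x = contract Λ α x + contract Λ β x := by
    intro x
    induction x using Finsupp.induction_linear with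
    | zero => simp
    | add x y hx hy => rw [map_add, hx, hy, map_add, map_add]; abel
    | single n h => simp [contract]
  ext1 Q
  induction Q using Fock.induction with
  | algebraMap r => simp [annihilationFock_algebraMap]
  | gen x => simp [annihilationFock_gen, hc]
  | mul a b ha hb =>
    rw [LinearMap.add_apply] at *
    simp only [annihilationFock_mul, ha, hb, smul_add]
    abel
  | add a b ha hb => rw [map_add, map_add, ha, hb]

theorem annihilationFock_smul (c : ℂ) (α : Cartan L) :
    annihilationFock Λ (c • α) = c • annihilationFock Λ α := by
  have hc : ∀ x, contract Λ (c • α) x = c • contract Λ α x := by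
    intro x
    induction x using Finsupp.induction_linear with
    | zero => simp
    | add x y hx hy => rw [map_add, hx, hy, map_add, smul_add]
    | single n h =>
      simp only [contract, Finsupp.coe_lsum, LinearMap.comp_apply, map_zero, Finsupp.sum_single_index,
        LinearMap.smul_apply, map_smul, smul_comm c]
  ext1 Q
  induction Q using Fock.induction with
  | algebraMap r => simp [annihilationFock_algebraMap]
  | gen x => simp [annihilationFock_gen, hc]
  | mul a b ha hb =>
    rw [LinearMap.smul_apply] at *
    simp only [annihilationFock_mul, ha, hb, smul_add]
    rw [smul_comm c a, smul_comm c b]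
  | add a b ha hb => rw [map_add, map_add, ha, hb]

end Heisenberg

section Space

variable {L : Type*} [AddCommGroup L] {Λ : EvenLattice L} {G : Type*} [Group G]
  (E : CentralExtension Λ G)

/-- The image `ā ∈ L` of `a ∈ G`. -/
def bar (a : G) : L := (E.proj a).toAdd

/-- The relations `(-1) a = - a` in the group algebra of `G`. -/
def signRelations : Submodule ℂ (G →₀ ℂ) :=
  Submodule.span ℂ (Set.range fun a : G => Finsupp.single (E.neg * a) 1 + Finsupp.single a 1)

/-- `ℂ{L} = ℂ[G] ⊗_{⟨±1⟩} ℂ`, where `-1` acts on `ℂ` as `-1`. -/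
abbrev TwistedGroupAlgebra : Type _ := (G →₀ ℂ) ⧸ signRelations E

/-- The element `a ⊗ 1` of `ℂ{L}`. -/
def tw (a : G) : TwistedGroupAlgebra E := (signRelations E).mkQ (Finsupp.single a 1)

theorem tw_neg (a : G) : tw E (E.neg * a) = - tw E a := by
  rw [eq_neg_iff_add_eq_zero, tw, tw, ← map_add, Submodule.mkQ_apply,
    Submodule.Quotient.mk_eq_zero]
  exact Submodule.subset_span ⟨a, rfl⟩

/-- The linear map on `ℂ{L}` with prescribed values on the elements `a ⊗ 1`. -/
def twLift {M : Type*} [AddCommGroup M] [Module ℂ M] (f : G → M)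
    (hf : ∀ a, f (E.neg * a) = - f a) : TwistedGroupAlgebra E →ₗ[ℂ] M :=
  (signRelations E).liftQ (Finsupp.linearCombination ℂ f) (by
    rw [signRelations, Submodule.span_le]
    rintro _ ⟨a, rfl⟩
    simp [hf])

theorem twLift_tw {M : Type*} [AddCommGroup M] [Module ℂ M] (f : G → M)
    (hf : ∀ a, f (E.neg * a) = - f a) (a : G) : twLift E f hf (tw E a) = f a := by
  simp [twLift, tw]

theorem bar_neg_mul (a : G) : bar E (E.neg * a) = bar E a := by
  have h : E.proj E.neg = 1 := (E.ker _).2 (Or.inr rfl)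
  simp [bar, h]

/-- `V_L = M(1) ⊗ ℂ{L}`. -/
abbrev VL : Type _ := Fock L ⊗[ℂ] TwistedGroupAlgebra E

/-- `ι(a) = 1 ⊗ (a ⊗ 1) ∈ V_L`. -/
def iota (a : G) : VL E := 1 ⊗ₜ tw E a

/-- The action of `h(0)` on `ℂ{L}`: `h · ι(a) = ⟨h, ā⟩ ι(a)`. -/
def zeroMode (h : Cartan L) : TwistedGroupAlgebra E →ₗ[ℂ] TwistedGroupAlgebra E :=
  twLift E (fun a => cform Λ h (1 ⊗ₜ bar E a) • tw E a)
    (fun a => by rw [bar_neg_mul, tw_neg, smul_neg])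

theorem tw_ext {M : Type*} [AddCommGroup M] [Module ℂ M] {f g : TwistedGroupAlgebra E →ₗ[ℂ] M}
    (h : ∀ a, f (tw E a) = g (tw E a)) : f = g := by
  apply Submodule.linearMap_qext
  ext a
  simpa [tw] using h a

/-- The family `(h(j) v)_{j ≥ 0}`, where `h(0)` acts on the factor `ℂ{L}` and `h(j)`, `j > 0`,
acts on the factor `M(1)`. -/
def annihilation : Cartan L →ₗ[ℂ] VL E →ₗ[ℂ] (ℕ →₀ VL E) where
  toFun h :=
    (TensorProduct.finsuppLeft ℂ ℂ (Fock L) (TwistedGroupAlgebra E) ℕ).toLinearMap ∘ₗ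
        (annihilationFock Λ h).rTensor (TwistedGroupAlgebra E) +
      Finsupp.lsingle 0 ∘ₗ (zeroMode E h).lTensor (Fock L)
  map_add' α β := by
    have h : zeroMode E (α + β) = zeroMode E α + zeroMode E β :=
      tw_ext E fun a => by simp [zeroMode, twLift_tw, add_smul]
    rw [annihilationFock_add, h, LinearMap.rTensor_add, LinearMap.lTensor_add, LinearMap.comp_add,
      LinearMap.comp_add]
    abel
  map_smul' c α := by
    have h : zeroMode E (c • α) = c • zeroMode E α :=
      tw_ext E fun a => by simp [zeroMode, twLift_tw, mul_smul]
    rw [annihilationFock_smul, h, LinearMap.rTensor_smul, LinearMap.lTensor_smul,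
      LinearMap.comp_smul, LinearMap.comp_smul, RingHom.id_apply, smul_add]

theorem annihilation_tmul (h : Cartan L) (P : Fock L) (a : G) (j : ℕ) :
    annihilation E h (P ⊗ₜ tw E a) j = annihilationFock Λ h P j ⊗ₜ tw E a +
      (if j = 0 then cform Λ h (1 ⊗ₜ bar E a) else 0) • (P ⊗ₜ tw E a) := by
  by_cases hj : j = 0
  · subst hj
    simp [annihilation, zeroMode, twLift_tw]
  · simp [annihilation, hj]

theorem VL_ext {M : Type*} [AddCommGroup M] [Module ℂ M] {f g : VL E →ₗ[ℂ] M}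
    (h : ∀ P a, f (P ⊗ₜ tw E a) = g (P ⊗ₜ tw E a)) : f = g := by
  apply TensorProduct.ext
  ext1 P
  exact tw_ext E fun a => h P a

theorem annihilation_comm (α β : Cartan L) (i j : ℕ) (v : VL E) :
    annihilation E α (annihilation E β v j) i = annihilation E β (annihilation E α v i) j := by
  have h : Finsupp.lapply i ∘ₗ annihilation E α ∘ₗ Finsupp.lapply j ∘ₗ annihilation E β =
      Finsupp.lapply j ∘ₗ annihilation E β ∘ₗ Finsupp.lapply i ∘ₗ annihilation E α := by
    apply VL_ext
    intro P a
    simp only [LinearMap.comp_apply, Finsupp.lapply_apply, annihilation_tmul, map_add, map_smul,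
      annihilationFock_comm Λ α β i j, smul_add,
      smul_comm (if i = 0 then _ else _) (if j = 0 then _ else (0 : ℂ))]
    abel
  exact LinearMap.congr_fun h v

/-! ### Vertex operators -/

/-- The creation part of `∂^n h(z) / n!`: for `h(-n-1)` it is
`∑_{j ≥ 0} binom(n+j, n) h(-n-j-1) z^j`. -/
def creationSeries (x : ℕ →₀ Cartan L) : HahnSeries ℤ (Fock L) :=
  HahnSeries.ofPowerSeries ℤ (Fock L) (PowerSeries.mk fun j =>
    Finsupp.lsum ℂ (fun n => ((n + j).choose n : ℂ) • creation (n + j)) x)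

theorem creationSeries_add (x y : ℕ →₀ Cartan L) :
    creationSeries (x + y) = creationSeries x + creationSeries y := by
  rw [creationSeries, creationSeries, creationSeries, ← map_add]
  congr 1
  apply PowerSeries.ext
  intro j
  simp only [PowerSeries.coeff_mk, map_add]

theorem creationSeries_smul (c : ℂ) (x : ℕ →₀ Cartan L) :
    creationSeries (c • x) = HahnSeries.C (algebraMap ℂ (Fock L) c) * creationSeries x := by
  rw [creationSeries, creationSeries, ← HahnSeries.ofPowerSeries_C, ← map_mul]
  congr 1
  apply PowerSeries.ext
  intro j
  simp only [PowerSeries.coeff_mk, map_smul, PowerSeries.coeff_C_mul, Algebra.smul_def]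

/-- The part of `∂^n h(z) / n!` with the modes `h(j)`, `j ≥ 0`, applied to `v`: for `h(-n-1)` it
is the Laurent polynomial `∑_{j ≥ 0} (-1)^n binom(n+j, n) h(j) v z^(-n-1-j)`. -/
def annihilationSeries : (ℕ →₀ Cartan L) →ₗ[ℂ] VL E →ₗ[ℂ] (ℤ →₀ VL E) :=
  Finsupp.lsum ℂ fun n =>
    LinearMap.compRight ℂ (Finsupp.lsum ℂ fun j : ℕ =>
      ((-1) ^ n * ((n + j).choose n : ℂ)) • Finsupp.lsingle (-(n : ℤ) - 1 - j)) ∘ₗ annihilation E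

/-- The extension of `X(z) : V_L → V_L((z))` to Laurent polynomials:
`∑ w_k z^k ↦ ∑ z^k X(z) w_k`. -/
def extend : VertexOperator ℂ (VL E) →ₗ[ℂ] ((ℤ →₀ VL E) →ₗ[ℂ] HahnModule ℤ ℂ (VL E)) where
  toFun X := Finsupp.lsum ℂ fun k : ℤ =>
    seriesAction (Fock L) (VL E) (HahnSeries.single k 1) ∘ₗ X
  map_add' X Z := by
    apply Finsupp.lhom_ext
    intro k v
    simp
  map_smul' c X := by
    apply Finsupp.lhom_ext
    intro k v
    simp only [Finsupp.lsum_single, LinearMap.comp_apply, LinearMap.smul_apply, map_smul,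
      RingHom.id_apply]

theorem extend_single (X : VertexOperator ℂ (VL E)) (k : ℤ) (v : VL E) :
    extend E X (Finsupp.single k v) =
      seriesAction (Fock L) (VL E) (HahnSeries.single k 1) (X v) := by
  simp [extend]

/-- The normal ordered product of `∂^n h(z) / n!` with `X(z)`, for `h(-n-1)`: creation
operators are placed to the left of `X(z)`, the modes `h(j)`, `j ≥ 0`, to the right. -/
def normalOrder : (ℕ →₀ Cartan L) →ₗ[ℂ] Module.End ℂ (VertexOperator ℂ (VL E)) where
  toFun x :=
    LinearMap.compRight ℂ (seriesAction (Fock L) (VL E) (creationSeries x)) +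
      LinearMap.lcomp ℂ _ (annihilationSeries E x) ∘ₗ extend E
  map_add' x y := by
    apply LinearMap.ext; intro X; apply LinearMap.ext; intro v
    simp [creationSeries_add]
    abel
  map_smul' c x := by
    apply LinearMap.ext; intro X; apply LinearMap.ext; intro v
    rw [creationSeries_smul, map_mul, seriesAction_C, map_smul]
    simp only [LinearMap.add_apply, LinearMap.comp_apply, LinearMap.compRight_apply,
      LinearMap.lcomp_apply, LinearMap.smul_apply, Module.End.mul_apply, Module.End.one_apply,
      map_smul, RingHom.id_apply, smul_add]

theorem normalOrder_apply (x : ℕ →₀ Cartan L) (X : VertexOperator ℂ (VL E)) (v : VL E) :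
    normalOrder E x X v = seriesAction (Fock L) (VL E) (creationSeries x) (X v) +
      extend E X (annihilationSeries E x v) := rfl

theorem annihilationSeries_single (n N : ℕ) (α : Cartan L) (v : VL E)
    (hN : ∀ j, N ≤ j → annihilation E α v j = 0) :
    annihilationSeries E (Finsupp.single n α) v = ∑ j ∈ Finset.range N,
      ((-1) ^ n * ((n + j).choose n : ℂ)) •
        Finsupp.single (-(n : ℤ) - 1 - j) (annihilation E α v j) := by
  have h : annihilationSeries E (Finsupp.single n α) v = (annihilation E α v).sum fun j w =>
      ((-1) ^ n * ((n + j).choose n : ℂ)) • Finsupp.single (-(n : ℤ) - 1 - j) w := by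
    rw [annihilationSeries, Finsupp.lsum_single]
    rfl
  rw [h, Finsupp.sum_of_support_subset]
  · intro j hj
    rw [Finset.mem_range]
    by_contra hc
    exact Finsupp.mem_support_iff.1 hj (hN j (not_lt.1 hc))
  · simp

theorem normalOrder_single (m N : ℕ) (β : Cartan L) (X : VertexOperator ℂ (VL E)) (w : VL E)
    (hN : ∀ j, N ≤ j → annihilation E β w j = 0) :
    normalOrder E (Finsupp.single m β) X w =
      seriesAction (Fock L) (VL E) (creationSeries (Finsupp.single m β)) (X w) +
        ∑ j ∈ Finset.range N, ((-1) ^ m * ((m + j).choose m : ℂ)) •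
          seriesAction (Fock L) (VL E) (HahnSeries.single (-(m : ℤ) - 1 - j) 1)
            (X (annihilation E β w j)) := by
  rw [normalOrder_apply, annihilationSeries_single E m N β w hN]
  simp only [map_sum, map_smul, extend_single]

theorem normalOrder_comm_aux {V W R : Type*} [AddCommGroup W] [Module ℂ W] [CommRing R]
    (ρ : R →+* Module.End ℂ W) (X : V → W) (N : ℕ) (c d : R) (y z : ℕ → R) (k l : ℕ → ℂ)
    (v : V) (a b : ℕ → V) (ab ba : ℕ → ℕ → V) (h : ∀ i j, ab i j = ba j i) :
    ρ c (ρ d (X v) + ∑ j ∈ Finset.range N, l j • ρ (z j) (X (b j))) +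
        ∑ i ∈ Finset.range N, k i • ρ (y i)
          (ρ d (X (a i)) + ∑ j ∈ Finset.range N, l j • ρ (z j) (X (ab i j))) =
      ρ d (ρ c (X v) + ∑ i ∈ Finset.range N, k i • ρ (y i) (X (a i))) +
        ∑ j ∈ Finset.range N, l j • ρ (z j)
          (ρ c (X (b j)) + ∑ i ∈ Finset.range N, k i • ρ (y i) (X (ba j i))) := by
  have hc : ∀ (f g : R) (w : W), ρ f (ρ g w) = ρ (f * g) w := fun f g w => by
    rw [map_mul, Module.End.mul_apply]
  simp only [map_add, map_sum, map_smul, smul_add, Finset.sum_add_distrib, Finset.smul_sum,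
    smul_smul, hc, h]
  rw [Finset.sum_comm (s := Finset.range N) (t := Finset.range N)
    (f := fun i j => (k i * l j) • ρ (y i * z j) (X (ba j i)))]
  simp only [mul_comm]
  abel

theorem normalOrder_comm (x y : ℕ →₀ Cartan L) :
    normalOrder E x * normalOrder E y = normalOrder E y * normalOrder E x := by
  induction x using Finsupp.induction_linear with
  | zero => simp
  | add x x2 h1 h2 => rw [map_add, add_mul, mul_add, h1, h2]
  | single n α =>
    induction y using Finsupp.induction_linear with
    | zero => simp
    | add y y2 h1 h2 => rw [map_add, mul_add, add_mul, h1, h2]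
    | single m β =>
      apply LinearMap.ext; intro X; apply LinearMap.ext; intro v
      obtain ⟨N, hN⟩ : ∃ N, (annihilation E α v).support ∪ (annihilation E β v).support ⊆
          Finset.range N := Finset.exists_nat_subset_range _
      have hα : ∀ j, N ≤ j → annihilation E α v j = 0 := fun j hj => by
        by_contra hc
        have := hN (Finset.mem_union_left _ (Finsupp.mem_support_iff.2 hc))
        exact absurd (Finset.mem_range.1 this) (not_lt.2 hj)
      have hβ : ∀ j, N ≤ j → annihilation E β v j = 0 := fun j hj => by
        by_contra hc
        have := hN (Finset.mem_union_right _ (Finsupp.mem_support_iff.2 hc))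
        exact absurd (Finset.mem_range.1 this) (not_lt.2 hj)
      have hβα : ∀ i j, N ≤ j → annihilation E β (annihilation E α v i) j = 0 := fun i j hj => by
        rw [← annihilation_comm, hβ j hj, map_zero, Finsupp.zero_apply]
      have hαβ : ∀ i j, N ≤ j → annihilation E α (annihilation E β v i) j = 0 := fun i j hj => by
        rw [← annihilation_comm, hα j hj, map_zero, Finsupp.zero_apply]
      rw [Module.End.mul_apply, Module.End.mul_apply, normalOrder_single E n N α _ v hα,
        normalOrder_single E m N β _ v hβ, normalOrder_single E m N β _ v hβ,
        normalOrder_single E n N α _ v hα]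
      simp only [normalOrder_single E m N β _ _ (hβα _), normalOrder_single E n N α _ _ (hαβ _)]
      exact normalOrder_comm_aux (seriesAction (Fock L) (VL E)) X N _ _ _ _ _ _ v _ _ _ _
        (fun i j => annihilation_comm E β α j i v)

/-- `exp(∑_{n > 0} ā(-n) z^n / n)`. -/
def expCreation (a : G) : HahnSeries ℤ (Fock L) :=
  HahnSeries.ofPowerSeries ℤ (Fock L) ((PowerSeries.exp ℂ).subst
    (PowerSeries.mk fun n =>
      if n = 0 then 0 else (n : ℂ)⁻¹ • creation (n - 1) (1 ⊗ₜ bar E a) : PowerSeries (Fock L)))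

/-- The operator `exp(-∑_{n > 0} ā(n) z^(-n) / n) : M(1) → M(1)[z⁻¹]`, with `z⁻¹` the polynomial
variable. The exponent is a derivation which maps `h(-m)` to `-⟨ā, h⟩ z^(-m)`, so its exponential
is the algebra map with `h(-m) ↦ h(-m) - ⟨ā, h⟩ z^(-m)`. -/
def expAnnihilation (a : G) : Fock L →ₐ[ℂ] Polynomial (Fock L) :=
  Fock.lift
    (Finsupp.lsum ℂ fun m =>
      (Polynomial.CAlgHom : Fock L →ₐ[ℂ] Polynomial (Fock L)).toLinearMap ∘ₗ creation m -
        LinearMap.toSpanSingleton ℂ (Polynomial (Fock L)) (Polynomial.X ^ (m + 1)) ∘ₗ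
          cform Λ (1 ⊗ₜ bar E a))
    (fun _ _ => mul_comm _ _)

/-- Substitution of `z⁻¹` for the polynomial variable. -/
def polynomialToSeries : Polynomial (Fock L) →+* HahnSeries ℤ (Fock L) :=
  Polynomial.eval₂RingHom HahnSeries.C (HahnSeries.single (-1) 1)

/-- The vertex operator `Y(ι(a), z)`:
`Q ⊗ ι(b) ↦ z^⟨ā, b̄⟩ exp(∑_{n > 0} ā(-n) z^n / n) exp(-∑_{n > 0} ā(n) z^(-n) / n) Q ⊗ ι(ab)`. -/
def vertexIota (a : G) : VertexOperator ℂ (VL E) :=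
  TensorProduct.lift (LinearMap.flip (twLift E
    (fun b =>
      { toFun := fun Q => seriesAction (Fock L) (VL E)
          (HahnSeries.single (Λ.form (bar E a) (bar E b)) 1 * expCreation E a *
            polynomialToSeries (expAnnihilation E a Q))
          (constSeries (VL E) (iota E (a * b)))
        map_add' := fun P Q => by simp only [map_add, mul_add, LinearMap.add_apply]
        map_smul' := fun c Q => by
          have h : polynomialToSeries (expAnnihilation E a (c • Q)) =
              HahnSeries.C (algebraMap ℂ (Fock L) c) *
                polynomialToSeries (expAnnihilation E a Q) := by
            rw [map_smul, Algebra.smul_def, map_mul, Polynomial.algebraMap_apply]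
            simp [polynomialToSeries]
          rw [h, mul_left_comm, map_mul, seriesAction_C]
          rfl })
    (fun b => by
      apply LinearMap.ext
      intro Q
      have h : iota E (a * (E.neg * b)) = - iota E (a * b) := by
        rw [← mul_assoc, ← E.neg_central, mul_assoc, iota, tw_neg, TensorProduct.tmul_neg, iota]
      simp only [LinearMap.coe_mk, AddHom.coe_mk, LinearMap.neg_apply, bar_neg_mul, h,
        map_neg])))

theorem vertexIota_tmul (a b : G) (Q : Fock L) :
    vertexIota E a (Q ⊗ₜ tw E b) = seriesAction (Fock L) (VL E)
      (HahnSeries.single (Λ.form (bar E a) (bar E b)) 1 * expCreation E a *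
        polynomialToSeries (expAnnihilation E a Q))
      (constSeries (VL E) (iota E (a * b))) := by
  simp [vertexIota, twLift_tw]

/-- `Y(·, z)` on the subspace `ℂ{L}` of `V_L`. -/
def vertexTw : TwistedGroupAlgebra E →ₗ[ℂ] VertexOperator ℂ (VL E) :=
  twLift E (vertexIota E) (fun a => by
    apply VL_ext
    intro Q b
    have h : iota E (E.neg * a * b) = - iota E (a * b) := by
      rw [mul_assoc, iota, tw_neg, TensorProduct.tmul_neg, iota]
    rw [LinearMap.neg_apply, vertexIota_tmul, vertexIota_tmul, h, map_neg, map_neg, bar_neg_mul]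
    simp only [expCreation, expAnnihilation, bar_neg_mul])

/-- The iterated normal ordered product: `h_1(-n_1) ⋯ h_k(-n_k) ∈ M(1)` maps `X(z)` to the normal
ordered product of `∂^(n_i - 1) h_i(z) / (n_i - 1)!`, `1 ≤ i ≤ k`, and `X(z)`. -/
def normalOrderFock : Fock L →ₐ[ℂ] Module.End ℂ (VertexOperator ℂ (VL E)) :=
  Fock.lift (normalOrder E) (normalOrder_comm E)

/-- The vertex operator map of `V_L`: `Y(h_1(-n_1) ⋯ h_k(-n_k) ⊗ ι(a), z)` is the normal ordered
product of `∂^(n_i - 1) h_i(z) / (n_i - 1)!`, `1 ≤ i ≤ k`, and `Y(ι(a), z)`. -/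
def Y : VL E →ₗ[ℂ] VertexOperator ℂ (VL E) :=
  TensorProduct.lift (LinearMap.mk₂ ℂ (fun P c => normalOrderFock E P (vertexTw E c))
    (fun P Q c => by rw [map_add, LinearMap.add_apply])
    (fun r P c => by rw [map_smul, LinearMap.smul_apply])
    (fun P c d => by rw [map_add, map_add])
    (fun r P c => by rw [map_smul, map_smul]))

/-- The Virasoro element `ω = (1/2) ∑ h_i(-1)^2 1`, `(h_i)` an orthonormal basis of `𝔥`. -/
def omega [Module.Free ℤ L] [Module.Finite ℤ L] : VL E :=
  (1 / 2 : ℂ) • ∑ i, (creation 0 (orthonormalBasis Λ i) ^ 2) ⊗ₜ tw E 1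

/-- The automorphism of `V_L` induced by an automorphism `θ` of `G` which lifts `-1`:
`h_1(-n_1) ⋯ h_k(-n_k) ⊗ ι(a) ↦ (-h_1)(-n_1) ⋯ (-h_k)(-n_k) ⊗ ι(θ a)`. -/
def thetaMap (θ : G ≃* G) (hθ : ∀ a, bar E (θ a) = - bar E a) : VL E →ₗ[ℂ] VL E :=
  TensorProduct.map
    (Fock.lift (-Fock.gen) (fun _ _ => mul_comm _ _) : Fock L →ₐ[ℂ] Fock L).toLinearMap
    (twLift E (fun a => tw E (θ a)) (fun a => by
      have h1 : E.proj E.neg = 1 := (E.ker _).2 (Or.inr rfl)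
      have h2 : E.proj (θ E.neg) = 1 := by
        have h3 := hθ E.neg
        rw [bar, bar, h1] at h3
        exact Multiplicative.toAdd.injective (by simpa using h3)
      have h4 : θ E.neg = E.neg := by
        rcases (E.ker _).1 h2 with h | h
        · exact absurd (θ.injective (h.trans (map_one θ).symm)) E.neg_ne_one
        · exact h
      rw [map_mul, h4, tw_neg]))

end Space

end LatticeVOA

end

noncomputable section

namespace LatticeVOA

/-! Write `O` for `O_θ(V_L)`. Only the relations coming from vectors `u` with `θu = -u` are needed.
For such `u`, the vector `L(-1)u` is again odd, of weight one higher, and `Y(L(-1)u, z) = d/dz Y(u,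
z)`. Integration by parts therefore gives `Res_z (1+z)^(wt u - 1/2) z^(-1-p) Y(u, z) v ∈ O` for
every `p ≥ 0`, not just `p = 0` (`residue_mem_zhuO`).

For `u = h(-1)1` this expresses `h(-p-1)v` modulo `O` through the vectors `h(-q-1)v` with `q < p`
and `h(i)v` with `i ≥ 0` (`heisenberg_relation`). Induction on polynomial degree, and within it on
the mode, leaves only the vectors `ι(a)` (`zhuO_sup_span_iota`).

It remains to compare `ι(ab)` with `ι(θ(a)b)`, whose lattice degrees differ by `2ā`. Let `m = ⟨ā,
b̄⟩ ≥ 0` and `n = ⟨ā, ā⟩/2`, and apply the relation with `p = m` to the odd vector `ι(a) - ι(θa)`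
and `v = ι(b)`. The first summand contributes exactly `ι(ab)`; the second contributes the
coefficient of `z^(2m)` in `(1+z)^(n-1/2) ∑ S_k ι(θ(a)b) z^k`, with `S_k` the Schur polynomials of
`θa`. Under a functional `ℓ` vanishing on `O`, the Heisenberg relations become a first order
differential equation for the series `∑ ℓ(S_k ι(θ(a)b)) z^k`
(`sqrtSeries_mul_derivative_schurSeries`). Its solution is `(1+z)^(-n) ((1+√(1+z))/2)^(2m)
ℓ(ι(θ(a)b))` (`one_add_X_pow_mul_eq`). The required coefficient of `(1+z)^(-1/2)
((1+√(1+z))/2)^(2m)` is `16^(-m)` (`coeff_invSqrtSeries_mul_sqrtMean_pow`), so `ι(ab) ≡ 16^(-m)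
ι(θ(a)b)`. Since `ā` is arbitrary, each `ι(c)` is proportional modulo `O` to the chosen
representative of its coset of `2L`. -/

/-- The coefficient of `z^n` in a Laurent series with coefficients in `V`. -/
def co {V : Type*} [AddCommGroup V] [Module ℂ V] (n : ℤ) : HahnModule ℤ ℂ V →ₗ[ℂ] V where
  toFun f := ((HahnModule.of ℂ).symm f).coeff n
  map_add' _ _ := rfl
  map_smul' _ _ := rfl

/-! ### Coefficients of Laurent series and residues as finite sums. -/

section Coefficients

variable {V : Type*} [AddCommGroup V] [Module ℂ V]

theorem exists_co_eq_zero (f : HahnModule ℤ ℂ V) : ∃ M : ℤ, ∀ n < M, co n f = 0 :=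
  ⟨((HahnModule.of ℂ).symm f).order, fun _ h => HahnSeries.coeff_eq_zero_of_lt_order h⟩

theorem coeff_ofPowerSeries_natCast {R : Type*} [Semiring R] (φ : PowerSeries R) (j : ℕ) :
    (HahnSeries.ofPowerSeries ℤ R φ).coeff (j : ℤ) = PowerSeries.coeff j φ :=
  HahnSeries.ofPowerSeries_apply_coeff φ j

theorem coeff_ofPowerSeries_of_neg {R : Type*} [Semiring R] (φ : PowerSeries R) {n : ℤ}
    (hn : n < 0) : (HahnSeries.ofPowerSeries ℤ R φ).coeff n = 0 := by
  rw [HahnSeries.ofPowerSeries_apply]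
  apply HahnSeries.embDomain_of_notMem_range
  rintro ⟨x, rfl⟩
  exact absurd hn (not_lt.2 (Int.natCast_nonneg x))

/-- A Laurent series is bounded below, so only finitely many products contribute. The truncation
point `N` is left free so that several series can later be cut at a common place. -/
theorem coeff_ofPowerSeries_smul {R W : Type*} [CommRing R] [AddCommGroup W] [Module R W]
    (φ : PowerSeries R) (x : HahnModule ℤ R W) (n : ℤ) (N : ℕ)
    (hN : ∀ j : ℕ, N ≤ j → ((HahnModule.of R).symm x).coeff (n - j) = 0) :
    ((HahnModule.of R).symm (HahnSeries.ofPowerSeries ℤ R φ • x)).coeff n =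
      ∑ j ∈ Finset.range N, PowerSeries.coeff j φ • ((HahnModule.of R).symm x).coeff (n - j) := by
  rw [HahnModule.coeff_smul]
  have hinj : Set.InjOn (fun j : ℕ => ((j : ℤ), n - (j : ℤ))) (Finset.range N : Set ℕ) := by
    intro i _ j _ h
    simpa using congrArg Prod.fst h
  rw [← Finset.sum_image (f := fun ij : ℤ × ℤ => (HahnSeries.ofPowerSeries ℤ R φ).coeff ij.1 •
    ((HahnModule.of R).symm x).coeff ij.2) (g := fun j : ℕ => ((j : ℤ), n - (j : ℤ))) hinj |>.trans
      (Finset.sum_congr rfl fun j _ => by simp only [coeff_ofPowerSeries_natCast])]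
  apply Finset.sum_subset
  · rintro ⟨i, j⟩ h
    simp only [Finset.mem_vaddAntidiagonal, HahnSeries.mem_support, vadd_eq_add] at h
    obtain ⟨h1, h2, h3⟩ := h
    have hi : 0 ≤ i := by
      by_contra hc
      exact h1 (coeff_ofPowerSeries_of_neg φ (not_le.1 hc))
    lift i to ℕ using hi
    simp only [Finset.mem_image, Finset.mem_range, Prod.mk.injEq, Nat.cast_inj]
    refine ⟨i, ?_, rfl, by omega⟩
    by_contra hc
    apply h2
    rw [← hN i (not_lt.1 hc)]
    congr 1
    omega
  · rintro ⟨i, j⟩ hij h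
    simp only [Finset.mem_image, Finset.mem_range, Prod.mk.injEq] at hij
    obtain ⟨k, hk, rfl, rfl⟩ := hij
    simp only [Finset.mem_vaddAntidiagonal, HahnSeries.mem_support, vadd_eq_add, not_and] at h
    by_cases h1 : (HahnSeries.ofPowerSeries ℤ R φ).coeff (k : ℤ) = 0
    · simp only [h1, zero_smul]
    · by_cases h2 : ((HahnModule.of R).symm x).coeff (n - k) = 0
      · simp only [h2, smul_zero]
      · exact absurd (by omega) (h h1 h2)

theorem coeff_single_smul {R W : Type*} [CommRing R] [AddCommGroup W] [Module R W]
    (k : ℤ) (x : HahnModule ℤ R W) (n : ℤ) :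
    ((HahnModule.of R).symm (HahnSeries.single k (1 : R) • x)).coeff n =
      ((HahnModule.of R).symm x).coeff (n - k) := by
  have := HahnModule.coeff_single_smul_vadd (r := (1 : R)) (x := x) (a := n - k) (b := k)
  rw [vadd_eq_add, add_sub_cancel, one_smul] at this
  exact this

variable {S : Type*} [CommRing S] [Algebra ℂ S] [Module S V] [IsScalarTower ℂ S V]

theorem co_seriesAction_ofPowerSeries (φ : PowerSeries S) (x : HahnModule ℤ ℂ V) (n : ℤ) (N : ℕ)
    (hN : ∀ j : ℕ, N ≤ j → co (n - j) x = 0) :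
    co n (seriesAction S V (HahnSeries.ofPowerSeries ℤ S φ) x) =
      ∑ j ∈ Finset.range N, PowerSeries.coeff j φ • co (n - j) x :=
  coeff_ofPowerSeries_smul φ (HahnModule.of S ((HahnModule.of ℂ).symm x)) n N hN

theorem co_seriesAction_single (k : ℤ) (x : HahnModule ℤ ℂ V) (n : ℤ) :
    co n (seriesAction S V (HahnSeries.single k 1) x) = co (n - k) x :=
  coeff_single_smul k (HahnModule.of S ((HahnModule.of ℂ).symm x)) n

theorem co_seriesAction_constSeries (f : HahnSeries ℤ S) (w : V) (n : ℤ) :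
    co n (seriesAction S V f (constSeries V w)) = f.coeff n • w := by
  change ((HahnModule.of S).symm (f • HahnModule.of S (HahnSeries.single (0 : ℤ) w))).coeff n = _
  rw [HahnModule.coeff_smul_right (s := {0}) (Set.isPWO_singleton _)
    (by simpa using HahnSeries.support_single_subset)]
  by_cases h : f.coeff n = 0
  · rw [h, zero_smul]
    apply Finset.sum_eq_zero
    rintro ⟨i, j⟩ hij
    simp only [Finset.mem_vaddAntidiagonal, Set.mem_singleton_iff, vadd_eq_add] at hij
    obtain ⟨h1, rfl, rfl⟩ := hij
    simp at h
    simp [h]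
  · rw [Finset.sum_eq_single (n, 0)]
    · simp
    · rintro ⟨i, j⟩ hij hne
      simp only [Finset.mem_vaddAntidiagonal, Set.mem_singleton_iff, vadd_eq_add] at hij
      obtain ⟨h1, rfl, rfl⟩ := hij
      simp at hne
    · intro hn
      simp [Finset.mem_vaddAntidiagonal, h] at hn

theorem residue_eq_sum (s : ℂ) (k : ℤ) (f : HahnModule ℤ ℂ V) (N : ℕ)
    (hN : ∀ j : ℕ, N ≤ j → co (k - 1 - j) f = 0) :
    TwistedZhu.residue s k f =
      ∑ j ∈ Finset.range N, Ring.choose s j • co (k - 1 - j) f := by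
  have h := mul_smul (HahnSeries.single (-k) (1 : ℂ))
    (HahnSeries.ofPowerSeries ℤ ℂ (PowerSeries.binomialSeries ℂ s)) f
  rw [TwistedZhu.residue, h, coeff_single_smul,
    show (-1 : ℤ) - -k = k - 1 by ring, coeff_ofPowerSeries_smul _ _ _ N hN]
  simp only [PowerSeries.binomialSeries_coeff, smul_eq_mul, mul_one]
  rfl

theorem exists_co_sub_eq_zero (f : HahnModule ℤ ℂ V) (n : ℤ) :
    ∃ N : ℕ, ∀ M ≥ N, ∀ j : ℕ, M ≤ j → co (n - j) f = 0 := by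
  obtain ⟨M, hM⟩ := exists_co_eq_zero f
  exact ⟨(n - M + 1).toNat, fun N hN j hj => hM _ (by omega)⟩

theorem residue_add (s : ℂ) (k : ℤ) (f g : HahnModule ℤ ℂ V) :
    TwistedZhu.residue s k (f + g) = TwistedZhu.residue s k f + TwistedZhu.residue s k g := by
  simp [TwistedZhu.residue]

theorem residue_sub (s : ℂ) (k : ℤ) (f g : HahnModule ℤ ℂ V) :
    TwistedZhu.residue s k (f - g) = TwistedZhu.residue s k f - TwistedZhu.residue s k g := by
  rw [eq_sub_iff_add_eq, ← residue_add, sub_add_cancel]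

theorem succ_mul_choose_succ (s : ℂ) (j : ℕ) :
    ((j : ℂ) + 1) * Ring.choose s (j + 1) = (s - j) * Ring.choose s j := by
  have h := Ring.choose_add_smul_choose (s - j) 1 j
  rw [Ring.choose_one_right, add_comm 1 j, Nat.choose_symm_add, Nat.choose_one_right,
    nsmul_eq_mul, sub_add_cancel] at h
  push_cast at h
  rw [h, mul_comm]

/-- Integration by parts for `Res_z (1 + z)^(s+1) z^(-p-1) f'(z)`. -/
theorem residue_deriv (s : ℂ) (p : ℕ) (f g : HahnModule ℤ ℂ V)
    (h : ∀ n, co n g = ((n : ℂ) + 1) • co (n + 1) f) :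
    TwistedZhu.residue (s + 1) (1 + p) g = ((p : ℂ) + 1) • TwistedZhu.residue s (2 + p) f +
      ((p : ℂ) - s) • TwistedZhu.residue s (1 + p) f := by
  obtain ⟨N, hN⟩ := exists_co_sub_eq_zero f (p + 1)
  have hN' := hN N le_rfl
  rw [residue_eq_sum (s + 1) (1 + p) g (N + 1), residue_eq_sum s (2 + p) f (N + 1),
    residue_eq_sum s (1 + p) f N]
  -- Splitting off `j = 0` in two of the three sums makes all remaining terms multiples of the
  -- coefficient of `z^(p-j)` in `f`. Their equality is Pascal's rule together with `(j+1) binom(s,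
  -- j+1) = (s-j) binom(s, j)`.
  · rw [Finset.smul_sum, Finset.smul_sum, Finset.sum_range_succ', Finset.sum_range_succ' _ N,
      add_right_comm, ← Finset.sum_add_distrib]
    congr 1
    · apply Finset.sum_congr rfl
      intro j _
      rw [h, show (1 + p - 1 - ((j + 1 : ℕ) : ℤ) + 1 : ℤ) = p - j by push_cast; ring,
        show (2 + p - 1 - ((j + 1 : ℕ) : ℤ) : ℤ) = p - j by push_cast; ring,
        show (1 + p - 1 - (j : ℤ) : ℤ) = p - j by ring, smul_smul, smul_smul, smul_smul,
        ← add_smul]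
      congr 1
      rw [Ring.choose_succ_succ]
      have := succ_mul_choose_succ s j
      push_cast
      linear_combination (-1 : ℂ) * this
    · rw [h, smul_smul, smul_smul]
      congr 1
      · simp
      · congr 2; push_cast; ring
  · intro j hj
    rw [← hN' (j + 1) (by omega)]; congr 2; push_cast; ring
  · intro j hj
    rw [← hN' j (by omega)]; congr 2; ring
  · intro j hj
    rw [h, show (1 + p - 1 - (j : ℤ) + 1 : ℤ) = p + 1 - j by ring, hN' j (by omega),
      smul_zero]

end Coefficients

/-! ### Derivations of `M(1)`: translation and degree. -/

namespace Fock

variable {L : Type*} [AddCommGroup L]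

/-- The derivation of `M(1)` with prescribed values on the generators. -/
def derivation (f : (ℕ →₀ Cartan L) →ₗ[ℂ] Fock L) : Fock L →ₗ[ℂ] Fock L :=
  (TrivSqZeroExt.sndHom (Fock L) (Fock L)).restrictScalars ℂ ∘ₗ
    (Fock.lift ((TrivSqZeroExt.inlAlgHom ℂ (Fock L) (Fock L)).toLinearMap ∘ₗ Fock.gen +
        (TrivSqZeroExt.inrHom (Fock L) (Fock L)).restrictScalars ℂ ∘ₗ f)
          (fun _ _ => mul_comm _ _)).toLinearMap

variable (f : (ℕ →₀ Cartan L) →ₗ[ℂ] Fock L)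

theorem derivation_gen (x : ℕ →₀ Cartan L) : derivation f (gen x) = f x := by
  simp [derivation, Fock.lift_gen]

theorem derivation_algebraMap (c : ℂ) : derivation f (algebraMap ℂ (Fock L) c) = 0 := by
  simp [derivation, TrivSqZeroExt.algebraMap_eq_inl']

theorem derivation_one : derivation f 1 = 0 := by
  rw [← map_one (algebraMap ℂ (Fock L)), derivation_algebraMap]

theorem derivation_mul (P Q : Fock L) :
    derivation f (P * Q) = P * derivation f Q + Q * derivation f P := by
  have h : ∀ R : Fock L, (Fock.lift
      ((TrivSqZeroExt.inlAlgHom ℂ (Fock L) (Fock L)).toLinearMap ∘ₗ Fock.gen +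
        (TrivSqZeroExt.inrHom (Fock L) (Fock L)).restrictScalars ℂ ∘ₗ f)
          (fun _ _ => mul_comm _ _) R).fst = R := by
    intro R
    induction R using Fock.induction with
    | algebraMap r => simp [TrivSqZeroExt.algebraMap_eq_inl']
    | gen x => simp [Fock.lift_gen]
    | mul a b ha hb => simp [ha, hb]
    | add a b ha hb => simp [ha, hb]
  simp [derivation, h, mul_comm]

/-- The derivation of `M(1)` with `h(-n-1) ↦ (n + 1) h(-n-2)`. -/
def translation : Fock L →ₗ[ℂ] Fock L :=
  derivation (Finsupp.lsum ℂ fun n => ((n : ℂ) + 1) • creation (n + 1))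

/-- The derivation of `M(1)` with `h(-n-1) ↦ (n + 1) h(-n-1)`. -/
def degree : Fock L →ₗ[ℂ] Fock L :=
  derivation (Finsupp.lsum ℂ fun n => ((n : ℂ) + 1) • creation n)

theorem gen_single (n : ℕ) (h : Cartan L) : gen (Finsupp.single n h) = creation n h := rfl

theorem translation_creation (n : ℕ) (h : Cartan L) :
    translation (creation n h) = ((n : ℂ) + 1) • creation (n + 1) h := by
  rw [translation, ← gen_single, derivation_gen]
  simp

theorem degree_creation (n : ℕ) (h : Cartan L) :
    degree (creation n h) = ((n : ℂ) + 1) • creation n h := by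
  rw [degree, ← gen_single, derivation_gen]
  simp [gen_single]

theorem induction_creation {motive : Fock L → Prop}
    (algebraMap : ∀ r, motive (algebraMap ℂ (Fock L) r))
    (creation : ∀ n h, motive (creation n h))
    (mul : ∀ a b, motive a → motive b → motive (a * b))
    (add : ∀ a b, motive a → motive b → motive (a + b)) (a : Fock L) : motive a := by
  refine Fock.induction algebraMap (fun x => ?_) mul add a
  induction x using Finsupp.induction_linear with
  | zero => simpa using algebraMap 0
  | add x y hx hy => rw [map_add]; exact add _ _ hx hy
  | single n h => exact creation n h

theorem degree_translation (P : Fock L) :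
    degree (translation P) = translation (degree P) + translation P := by
  induction P using induction_creation with
  | algebraMap r => simp [translation, degree, derivation_algebraMap]
  | creation n h =>
    simp only [translation_creation, degree_creation, map_smul, smul_smul, ← add_smul]
    congr 1
    push_cast
    ring
  | mul a b ha hb =>
    have h1 : ∀ P Q : Fock L, degree (P * Q) = P * degree Q + Q * degree P := derivation_mul _
    have h2 : ∀ P Q : Fock L, translation (P * Q) = P * translation Q + Q * translation P :=
      derivation_mul _
    simp only [h1, h2, map_add, ha, hb]
    ring
  | add a b ha hb =>
    simp only [map_add, ha, hb]
    abel

end Fock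

/-! ### Derivatives of normal ordered products. -/

section Derivative

variable {L : Type*} [AddCommGroup L] {Λ : EvenLattice L} {G : Type*} [Group G]
  (E : CentralExtension Λ G)

/-- `X'(z)` is the derivative of the vertex operator `X(z)`. -/
def IsDeriv (X X' : VertexOperator ℂ (VL E)) : Prop :=
  ∀ (v : VL E) (n : ℤ), co n (X' v) = ((n : ℂ) + 1) • co (n + 1) (X v)

variable {E} in
theorem IsDeriv.add {X X' Z Z' : VertexOperator ℂ (VL E)} (h : IsDeriv E X X')
    (h' : IsDeriv E Z Z') : IsDeriv E (X + Z) (X' + Z') := fun v n => by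
  simp only [LinearMap.add_apply, map_add, smul_add, h v n, h' v n]

variable {E} in
theorem IsDeriv.smul {X X' : VertexOperator ℂ (VL E)} (c : ℂ) (h : IsDeriv E X X') :
    IsDeriv E (c • X) (c • X') := fun v n => by
  simp only [LinearMap.smul_apply, map_smul, h v n, smul_comm c]

theorem exists_annihilation_eq_zero (h : Cartan L) (v : VL E) :
    ∃ N : ℕ, ∀ j, N ≤ j → annihilation E h v j = 0 := by
  obtain ⟨N, hN⟩ := Finset.exists_nat_subset_range (annihilation E h v).support
  refine ⟨N, fun j hj => ?_⟩
  by_contra hc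
  exact absurd (Finset.mem_range.1 (hN (Finsupp.mem_support_iff.2 hc))) (not_lt.2 hj)

theorem co_normalOrder_single (m : ℕ) (h : Cartan L) (X : VertexOperator ℂ (VL E)) (v : VL E)
    (n : ℤ) (M N : ℕ) (hM : ∀ j : ℕ, M ≤ j → co (n - j) (X v) = 0)
    (hN : ∀ j, N ≤ j → annihilation E h v j = 0) :
    co n (normalOrder E (Finsupp.single m h) X v) =
      ∑ j ∈ Finset.range M, ((m + j).choose m : ℂ) • creation (m + j) h • co (n - j) (X v) +
      ∑ j ∈ Finset.range N, ((-1) ^ m * ((m + j).choose m : ℂ)) •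
        co (n + m + 1 + j) (X (annihilation E h v j)) := by
  rw [normalOrder_single E m N h X v hN, map_add, creationSeries,
    co_seriesAction_ofPowerSeries _ _ _ M hM, map_sum]
  congr 1
  · apply Finset.sum_congr rfl
    intro j _
    simp [smul_assoc]
  · apply Finset.sum_congr rfl
    intro j _
    rw [map_smul, co_seriesAction_single]
    congr 3
    ring

theorem succ_mul_choose_succ_nat (m j : ℕ) :
    ((m : ℂ) + 1) * ((m + 1 + j).choose (m + 1) : ℂ) = (m + 1 + j) * ((m + j).choose m : ℂ) := by
  have h := Nat.add_one_mul_choose_eq (m + j) m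
  rw [show m + j + 1 = m + 1 + j by ring] at h
  have h' := congrArg (Nat.cast : ℕ → ℂ) h
  push_cast at h'
  linear_combination -h'

theorem succ_mul_choose_add_succ (m j : ℕ) :
    ((m : ℂ) + 1) * ((m + 1 + j).choose (m + 1) : ℂ) =
      (j + 1) * ((m + (j + 1)).choose m : ℂ) := by
  have h := Nat.choose_succ_right_eq (m + (j + 1)) m
  rw [show m + (j + 1) - m = j + 1 by omega] at h
  have h' := congrArg (Nat.cast : ℕ → ℂ) h
  push_cast at h'
  rw [show m + 1 + j = m + (j + 1) by ring]
  linear_combination h'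

/-- This is the Leibniz rule: differentiating `∂^m h(z) / m!` gives `(m+1) ∂^(m+1) h(z) / (m+1)!`.
It holds separately for the creation part and for the part with the modes `h(j)`, `j ≥ 0`, by two
binomial identities. -/
theorem IsDeriv.normalOrder_single (m : ℕ) (h : Cartan L) {X X' : VertexOperator ℂ (VL E)}
    (hX : IsDeriv E X X') : IsDeriv E (normalOrder E (Finsupp.single m h) X)
      (((m : ℂ) + 1) • normalOrder E (Finsupp.single (m + 1) h) X +
        normalOrder E (Finsupp.single m h) X') := by
  intro v n
  obtain ⟨N, hN⟩ := exists_annihilation_eq_zero E h v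
  obtain ⟨M, hM⟩ := exists_co_sub_eq_zero (X v) (n + 1)
  have hM' := hM M le_rfl
  have hz : ∀ j : ℕ, n + 1 - ((j + 1 : ℕ) : ℤ) = n - j := fun j => by push_cast; ring
  rw [co_normalOrder_single E m h X v (n + 1) (M + 1) N (fun j hj => hM' j (by omega)) hN,
    LinearMap.add_apply, map_add, LinearMap.smul_apply, map_smul,
    co_normalOrder_single E (m + 1) h X v n M N
      (fun j hj => by rw [← hM' (j + 1) (by omega), hz]) hN,
    co_normalOrder_single E m h X' v n (M + 1) N
      (fun j hj => by
        rw [hX, show n - (j : ℤ) + 1 = n + 1 - j by ring, hM' j (by omega), smul_zero]) hN]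
  simp only [show ∀ v n, co n (X' v) = ((n : ℂ) + 1) • co (n + 1) (X v) from hX]
  rw [smul_add, smul_add, add_add_add_comm]
  congr 1
  · rw [Finset.sum_range_succ', Finset.sum_range_succ', ← add_assoc, Finset.smul_sum,
      ← Finset.sum_add_distrib, smul_add, Finset.smul_sum]
    congr 1
    · apply Finset.sum_congr rfl
      intro j _
      rw [hz, show n - ((j + 1 : ℕ) : ℤ) + 1 = n - j by push_cast; ring,
        show m + 1 + j = m + (j + 1) by ring]
      rw [smul_comm (creation (m + (j + 1)) h) (_ : ℂ), smul_smul, smul_smul, smul_smul,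
        ← add_smul]
      congr 1
      have := succ_mul_choose_add_succ m j
      rw [show m + 1 + j = m + (j + 1) by ring] at this
      rw [this]
      push_cast
      ring
    · simp only [add_zero, Nat.choose_self, Nat.cast_one, one_smul, Nat.cast_zero, sub_zero]
      rw [smul_comm]
  · rw [Finset.smul_sum, Finset.smul_sum, ← Finset.sum_add_distrib]
    apply Finset.sum_congr rfl
    intro j _
    rw [show n + ((m + 1 : ℕ) : ℤ) + 1 + j = n + 1 + m + 1 + j by push_cast; ring,
      show n + (m : ℤ) + 1 + j + 1 = n + 1 + m + 1 + j by ring, smul_smul, smul_smul, smul_smul,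
      ← add_smul]
    congr 1
    have := succ_mul_choose_succ_nat m j
    push_cast
    rw [pow_succ]
    linear_combination -(-1) ^ m * this

theorem IsDeriv.normalOrderFock (P : Fock L) {X X' : VertexOperator ℂ (VL E)}
    (hX : IsDeriv E X X') : IsDeriv E (normalOrderFock E P X)
      (normalOrderFock E (Fock.translation P) X + normalOrderFock E P X') := by
  induction P using Fock.induction_creation generalizing X X' with
  | algebraMap r =>
    rw [Fock.translation, Fock.derivation_algebraMap, map_zero, LinearMap.zero_apply, zero_add,
      AlgHom.commutes]
    exact hX.smul r
  | creation n h =>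
    rw [Fock.translation_creation, map_smul, ← Fock.gen_single, ← Fock.gen_single,
      LatticeVOA.normalOrderFock, Fock.lift_gen, Fock.lift_gen]
    exact hX.normalOrder_single E n h
  | mul a b ha hb =>
    -- The hypothesis for `a` is applied to the operator already multiplied by `b`; this is why the
    -- induction is general in `X` and `X'`.
    have := ha (hb hX)
    rw [Fock.translation, Fock.derivation_mul, ← Fock.translation, map_add, map_mul, map_mul,
      mul_comm b, map_mul]
    simp only [LinearMap.add_apply, Module.End.mul_apply]
    rw [map_add] at this
    convert this using 1
    abel
  | add a b ha hb =>
    convert (ha hX).add (hb hX) using 1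
    · rw [map_add, LinearMap.add_apply]
    · simp only [map_add, LinearMap.add_apply]
      abel

end Derivative

/-! ### Schur polynomials and the action of the annihilation operators on them. -/

section ExpSeries

variable {L : Type*} [AddCommGroup L]

/-- The exponential has scalar coefficients while its argument has coefficients in `M(1)`; the chain
rule is applied after both are placed over `M(1)`. -/
theorem subst_eq_map_subst {R S : Type*} [CommRing R] [CommRing S] [Algebra R S]
    (f : PowerSeries R) {g : PowerSeries S} (hg : PowerSeries.HasSubst g) :
    f.subst g = (PowerSeries.map (algebraMap R S) f).subst g := by
  ext n
  rw [PowerSeries.coeff_subst' hg, PowerSeries.coeff_subst' hg]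
  refine finsum_congr fun d => ?_
  rw [PowerSeries.coeff_map, algebraMap_smul]

/-- The exponent `∑_{n > 0} h(-n) z^n / n`. -/
def creationExponent (h : Cartan L) : PowerSeries (Fock L) :=
  PowerSeries.mk fun n => if n = 0 then 0 else (n : ℂ)⁻¹ • creation (n - 1) h

theorem hasSubst_creationExponent (h : Cartan L) :
    PowerSeries.HasSubst (creationExponent h) :=
  PowerSeries.HasSubst.of_constantCoeff_zero' (by
    rw [← PowerSeries.coeff_zero_eq_constantCoeff_apply]
    simp [creationExponent])

/-- `exp(∑_{n > 0} h(-n) z^n / n)`. -/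
def expSeries (h : Cartan L) : PowerSeries (Fock L) :=
  (PowerSeries.exp ℂ).subst (creationExponent h)

/-- The series `∑_{n ≥ 0} h(-n-1) z^n`. -/
def creationPart (h : Cartan L) : PowerSeries (Fock L) :=
  PowerSeries.mk fun n => creation n h

theorem derivative_expSeries (h : Cartan L) :
    PowerSeries.derivative (Fock L) (expSeries h) = creationPart h * expSeries h := by
  have h1 : PowerSeries.derivative (Fock L)
      (PowerSeries.map (algebraMap ℂ (Fock L)) (PowerSeries.exp ℂ)) =
      PowerSeries.map (algebraMap ℂ (Fock L)) (PowerSeries.exp ℂ) := by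
    ext n
    conv_rhs => rw [← PowerSeries.derivative_exp ℂ]
    rw [PowerSeries.coeff_derivative, PowerSeries.coeff_map, PowerSeries.coeff_map,
      PowerSeries.coeff_derivative, map_mul]
    simp
  have h2 : PowerSeries.derivative (Fock L) (creationExponent h) = creationPart h := by
    ext n
    rw [PowerSeries.coeff_derivative]
    have : (n : Fock L) + 1 = algebraMap ℂ (Fock L) (n + 1) := by simp
    have h0 : (n : ℂ) + 1 ≠ 0 := Nat.cast_add_one_ne_zero n
    rw [this, mul_comm, ← Algebra.smul_def]
    simp only [creationExponent, creationPart, PowerSeries.coeff_mk, Nat.add_eq_zero_iff,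
      one_ne_zero, and_false, if_false, smul_smul, Nat.add_sub_cancel, Nat.cast_add, Nat.cast_one]
    rw [mul_inv_cancel₀ h0, one_smul]
  rw [expSeries, subst_eq_map_subst _ (hasSubst_creationExponent h),
    PowerSeries.derivative_subst (hasSubst_creationExponent h), h1, h2, mul_comm]

/-- The coefficient of `z^k` in `exp(∑_{n > 0} h(-n) z^n / n)`. -/
def schur (h : Cartan L) (k : ℕ) : Fock L := PowerSeries.coeff k (expSeries h)

theorem schur_zero (h : Cartan L) : schur h 0 = 1 := by
  rw [schur, expSeries, PowerSeries.coeff_subst' (hasSubst_creationExponent h),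
    finsum_eq_single _ 0]
  · simp
  · intro d hd
    have : PowerSeries.constantCoeff (creationExponent h) = 0 := by
      rw [← PowerSeries.coeff_zero_eq_constantCoeff_apply]
      simp [creationExponent]
    rw [PowerSeries.coeff_zero_eq_constantCoeff_apply, map_pow, this, zero_pow hd, smul_zero]

theorem succ_smul_schur_succ (h : Cartan L) (k : ℕ) :
    ((k : ℂ) + 1) • schur h (k + 1) =
      ∑ ij ∈ Finset.HasAntidiagonal.antidiagonal k, creation ij.1 h * schur h ij.2 := by
  have h1 := congrArg (PowerSeries.coeff k) (derivative_expSeries h)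
  rw [PowerSeries.coeff_derivative, PowerSeries.coeff_mul] at h1
  simp only [creationPart, PowerSeries.coeff_mk] at h1
  have : (k : Fock L) + 1 = algebraMap ℂ (Fock L) (k + 1) := by simp
  rw [Algebra.smul_def, ← this, mul_comm]
  exact h1

variable (Λ : EvenLattice L)

theorem annihilationFock_creation (α : Cartan L) (n : ℕ) (h : Cartan L) (i : ℕ) :
    annihilationFock Λ α (creation n h) i =
      if n + 1 = i then algebraMap ℂ (Fock L) ((n + 1) * cform Λ α h) else 0 := by
  rw [← Fock.gen_single, annihilationFock_gen]
  simp only [contract, Finsupp.coe_lsum, LinearMap.comp_apply, map_zero,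
    Finsupp.sum_single_index, Finsupp.lsingle_apply, Finsupp.single_apply, LinearMap.smul_apply,
    Algebra.linearMap_apply, smul_eq_mul]

theorem annihilationFock_mul_apply (α : Cartan L) (P Q : Fock L) (i : ℕ) :
    annihilationFock Λ α (P * Q) i =
      P * annihilationFock Λ α Q i + Q * annihilationFock Λ α P i := by
  rw [annihilationFock_mul]
  simp

theorem annihilationFock_one (α : Cartan L) : annihilationFock Λ α 1 = 0 := by
  rw [← map_one (algebraMap ℂ (Fock L)), annihilationFock_algebraMap]

theorem annihilationFock_zero_apply (α : Cartan L) (P : Fock L) :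
    annihilationFock Λ α P 0 = 0 := by
  induction P using Fock.induction_creation with
  | algebraMap r => simp [annihilationFock_algebraMap]
  | creation n h => simp [annihilationFock_creation]
  | mul a b ha hb => simp [annihilationFock_mul_apply, ha, hb]
  | add a b ha hb => simp [ha, hb]

/-- Since `α(i+1)` is a derivation sending `∑ h(-n) z^n / n` to `⟨α, h⟩ z^(i+1)`, it multiplies the
exponential by `⟨α, h⟩ z^(i+1)`. The proof reads this off coefficientwise from the recursion for
`(k+1) S_(k+1)`. -/
theorem annihilationFock_schur (α h : Cartan L) (i k : ℕ) :
    annihilationFock Λ α (schur h k) (i + 1) =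
      if i + 1 ≤ k then cform Λ α h • schur h (k - (i + 1)) else 0 := by
  induction k using Nat.strong_induction_on with
  | _ k ih =>
    cases k with
    | zero => simp [schur_zero, annihilationFock_one]
    | succ k =>
      have h0 : (k : ℂ) + 1 ≠ 0 := Nat.cast_add_one_ne_zero k
      apply (smul_right_injective _ h0)
      change ((k : ℂ) + 1) • _ = ((k : ℂ) + 1) • _
      have h1 : ((k : ℂ) + 1) • annihilationFock Λ α (schur h (k + 1)) (i + 1) =
          annihilationFock Λ α (((k : ℂ) + 1) • schur h (k + 1)) (i + 1) := by
        rw [map_smul, Finsupp.smul_apply]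
      rw [h1, succ_smul_schur_succ, map_sum, Finsupp.finsetSum_apply]
      simp only [annihilationFock_mul_apply, annihilationFock_creation]
      rw [Finset.sum_add_distrib]
      -- Contraction with the creation factor contributes `i + 1` copies of `⟨α, h⟩ S_(k-i)`;
      -- contraction with the Schur factor contributes `k - i` more, by the recursion read
      -- backwards. Together they give the factor `k + 1`.
      have h2 : ∑ x ∈ Finset.HasAntidiagonal.antidiagonal k, schur h x.2 *
          (if x.1 + 1 = i + 1 then algebraMap ℂ (Fock L) ((x.1 + 1) * cform Λ α h) else 0) =
          if i ≤ k then ((i : ℂ) + 1) • cform Λ α h • schur h (k - i) else 0 := by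
        split_ifs with hik
        · rw [Finset.sum_eq_single (i, k - i)]
          · simp only [if_true]
            rw [mul_comm, ← Algebra.smul_def, mul_smul]
          · rintro ⟨x, y⟩ hxy hne
            rw [Finset.HasAntidiagonal.mem_antidiagonal] at hxy
            rw [if_neg, mul_zero]
            intro hx
            apply hne
            simp only [add_left_inj] at hx hxy
            ext <;> simp <;> omega
          · intro hn
            exact absurd (Finset.HasAntidiagonal.mem_antidiagonal.2 (by simp; omega)) hn
        · apply Finset.sum_eq_zero
          rintro ⟨x, y⟩ hxy
          rw [Finset.HasAntidiagonal.mem_antidiagonal] at hxy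
          simp only at hxy
          rw [if_neg (by simp only; omega), mul_zero]
      have h3 : ∑ x ∈ Finset.HasAntidiagonal.antidiagonal k, creation x.1 h *
          annihilationFock Λ α (schur h x.2) (i + 1) =
          if i + 1 ≤ k then ((k : ℂ) - i) • cform Λ α h • schur h (k - i) else 0 := by
        rw [Finset.sum_congr rfl (g := fun x => creation x.1 h *
          if i + 1 ≤ x.2 then cform Λ α h • schur h (x.2 - (i + 1)) else 0)
          (fun x hx => by
            rw [ih x.2 (by have := Finset.HasAntidiagonal.mem_antidiagonal.1 hx; omega)])]
        split_ifs with hik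
        · obtain ⟨d, rfl⟩ := Nat.exists_eq_add_of_le hik
          have h4 := succ_smul_schur_succ h d
          rw [show i + 1 + d - i = d + 1 by omega, smul_comm,
            show ((i + 1 + d : ℕ) : ℂ) - i = d + 1 by push_cast; ring, h4, Finset.smul_sum]
          simp only [mul_ite, mul_zero]
          rw [← Finset.sum_filter]
          refine Finset.sum_bij' (fun x _ => (x.1, x.2 - (i + 1)))
            (fun x _ => (x.1, x.2 + (i + 1))) ?_ ?_ ?_ ?_ ?_
          · rintro ⟨x, y⟩ hx
            simp only [Finset.mem_filter, Finset.HasAntidiagonal.mem_antidiagonal] at hx ⊢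
            omega
          · rintro ⟨x, y⟩ hx
            simp only [Finset.mem_filter, Finset.HasAntidiagonal.mem_antidiagonal] at hx ⊢
            omega
          · rintro ⟨x, y⟩ hx
            simp only [Finset.mem_filter, Finset.HasAntidiagonal.mem_antidiagonal] at hx
            ext <;> simp
            omega
          · rintro ⟨x, y⟩ hx
            simp
          · rintro ⟨x, y⟩ hx
            simp
        · apply Finset.sum_eq_zero
          rintro ⟨x, y⟩ hxy
          rw [Finset.HasAntidiagonal.mem_antidiagonal] at hxy
          simp only at hxy
          rw [if_neg (by simp only; omega), mul_zero]
      rw [h2, h3, show k + 1 - (i + 1) = k - i by omega]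
      by_cases h5 : i ≤ k
      · rw [if_pos h5, if_pos (by omega : i + 1 ≤ k + 1)]
        by_cases h6 : i + 1 ≤ k
        · rw [if_pos h6, ← add_smul]
          congr 1
          ring
        · rw [if_neg h6, zero_add, show k = i by omega]
      · rw [if_neg h5, if_neg (by omega), if_neg (by omega)]
        simp

end ExpSeries

/-! ### The operator `z d/dz` on Laurent series. -/

section Euler

variable {R : Type*} [CommRing R]

/-- The Euler operator `z d/dz` on Laurent series. -/
def euler : HahnSeries ℤ R →+ HahnSeries ℤ R where
  toFun f := ⟨fun n => (n : R) * f.coeff n, f.isPWO_support'.mono (by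
    intro n hn h
    exact hn (by simp [h]))⟩
  map_zero' := by ext; simp
  map_add' f g := by ext; simp [mul_add]

theorem coeff_euler (f : HahnSeries ℤ R) (n : ℤ) : (euler f).coeff n = n * f.coeff n := rfl

theorem support_euler_subset (f : HahnSeries ℤ R) : (euler f).support ⊆ f.support := by
  intro n hn h
  exact hn (by simp [coeff_euler, h])

theorem euler_mul (f g : HahnSeries ℤ R) : euler (f * g) = euler f * g + f * euler g := by
  ext n
  rw [coeff_euler, HahnSeries.coeff_add, HahnSeries.coeff_mul,
    HahnSeries.coeff_mul_left' f.isPWO_support (support_euler_subset f),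
    HahnSeries.coeff_mul_right' g.isPWO_support (support_euler_subset g), Finset.mul_sum,
    ← Finset.sum_add_distrib]
  apply Finset.sum_congr rfl
  rintro ⟨i, j⟩ h
  simp only [Finset.mem_antidiagonal] at h
  rw [coeff_euler, coeff_euler, ← h.2.2]
  push_cast
  ring

theorem euler_single (k : ℤ) (r : R) :
    euler (HahnSeries.single k r) = HahnSeries.single k (k * r) := by
  ext n
  rw [coeff_euler, HahnSeries.coeff_single, HahnSeries.coeff_single]
  split_ifs with h
  · rw [h]
  · simp

theorem euler_ofPowerSeries (φ : PowerSeries R) :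
    euler (HahnSeries.ofPowerSeries ℤ R φ) =
      HahnSeries.single 1 1 * HahnSeries.ofPowerSeries ℤ R (PowerSeries.derivative R φ) := by
  ext n
  rw [coeff_euler, HahnSeries.coeff_single_mul, one_mul]
  rcases lt_trichotomy n 0 with h | rfl | h
  · rw [coeff_ofPowerSeries_of_neg _ h, coeff_ofPowerSeries_of_neg _ (by omega), mul_zero]
  · rw [coeff_ofPowerSeries_of_neg (PowerSeries.derivative R φ) (by omega : (0 : ℤ) - 1 < 0)]
    simp
  · obtain ⟨k, rfl⟩ : ∃ k : ℕ, n = (k + 1 : ℕ) := ⟨(n - 1).toNat, by omega⟩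
    rw [coeff_ofPowerSeries_natCast, show ((k + 1 : ℕ) : ℤ) - 1 = k by push_cast; ring,
      coeff_ofPowerSeries_natCast, PowerSeries.coeff_derivative]
    push_cast
    ring

end Euler

/-! ### The annihilation exponential and its derivative. -/

section VertexIota

variable {L : Type*} [AddCommGroup L] {Λ : EvenLattice L} {G : Type*} [Group G]
  (E : CentralExtension Λ G)

/-- The element `1 ⊗ ā` of `𝔥`. -/
abbrev cbar (a : G) : Cartan L := 1 ⊗ₜ bar E a

/-- The operator `exp(-∑_{n > 0} ā(n) z^(-n) / n) : M(1) → M(1)((z))`. -/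
def annihilationExp (a : G) : Fock L →+* HahnSeries ℤ (Fock L) :=
  polynomialToSeries.comp (expAnnihilation E a : Fock L →+* Polynomial (Fock L))

theorem annihilationExp_algebraMap (a : G) (c : ℂ) :
    annihilationExp E a (algebraMap ℂ (Fock L) c) = HahnSeries.C (algebraMap ℂ (Fock L) c) := by
  simp [annihilationExp, polynomialToSeries, Polynomial.algebraMap_apply]

theorem annihilationExp_creation (a : G) (n : ℕ) (h : Cartan L) :
    annihilationExp E a (creation n h) = HahnSeries.C (creation n h) -
      HahnSeries.single (-((n : ℤ) + 1)) (algebraMap ℂ (Fock L) (cform Λ (cbar E a) h)) := by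
  have h1 : expAnnihilation E a (creation n h) = Polynomial.C (creation n h) -
      Polynomial.C (algebraMap ℂ (Fock L) (cform Λ (cbar E a) h)) * Polynomial.X ^ (n + 1) := by
    rw [expAnnihilation, ← Fock.gen_single, Fock.lift_gen]
    simp [Algebra.smul_def, Fock.gen_single, Polynomial.algebraMap_apply]
  have h2 : annihilationExp E a (creation n h) =
    polynomialToSeries (expAnnihilation E a (creation n h)) := rfl
  rw [h2, h1]
  simp [polynomialToSeries, HahnSeries.single_pow]

/-- `(w_j)_j ↦ ∑_j z^(-j) exp(-∑_{n > 0} ā(n) z^(-n) / n) w_j`. -/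
def annihilationExpSum (a : G) : (ℕ →₀ Fock L) →+ HahnSeries ℤ (Fock L) :=
  Finsupp.liftAddHom fun j =>
    (AddMonoidHom.mulLeft (HahnSeries.single (-(j : ℤ)) 1)).comp
      (annihilationExp E a : Fock L →+ HahnSeries ℤ (Fock L))

theorem annihilationExpSum_single (a : G) (j : ℕ) (w : Fock L) :
    annihilationExpSum E a (Finsupp.single j w) =
      HahnSeries.single (-(j : ℤ)) 1 * annihilationExp E a w := by
  simp [annihilationExpSum]

theorem annihilationExpSum_smul (a : G) (P : Fock L) (x : ℕ →₀ Fock L) :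
    annihilationExpSum E a (P • x) = annihilationExp E a P * annihilationExpSum E a x := by
  induction x using Finsupp.induction_linear with
  | zero => simp
  | add x y hx hy => rw [smul_add, map_add, map_add, hx, hy, mul_add]
  | single n h =>
    rw [Finsupp.smul_single, annihilationExpSum_single, annihilationExpSum_single, smul_eq_mul,
      map_mul]
    ring

/-- Formally, `z d/dz` of the exponent `-∑ ā(j) z^(-j) / j` is `∑ ā(j) z^(-j)`. Both sides are
derivations along the ring map `annihilationExp`, so the generators suffice. -/
theorem euler_annihilationExp (a : G) (Q : Fock L) :
    euler (annihilationExp E a Q) =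
      annihilationExpSum E a (annihilationFock Λ (cbar E a) Q) := by
  induction Q using Fock.induction_creation with
  | algebraMap r =>
    rw [annihilationExp_algebraMap, annihilationFock_algebraMap, map_zero]
    change euler (HahnSeries.single 0 _) = 0
    rw [euler_single]
    simp
  | creation n h =>
    rw [annihilationExp_creation, map_sub, euler_single]
    change euler (HahnSeries.single 0 _) - _ = _
    have h1 : annihilationFock Λ (cbar E a) (creation n h) = Finsupp.single (n + 1)
        (algebraMap ℂ (Fock L) ((n + 1) * cform Λ (cbar E a) h)) := by
      ext i
      rw [annihilationFock_creation, Finsupp.single_apply]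
    rw [euler_single, h1, annihilationExpSum_single, annihilationExp_algebraMap]
    change _ = HahnSeries.single (-((n + 1 : ℕ) : ℤ)) 1 * HahnSeries.single 0 _
    rw [HahnSeries.single_mul_single]
    simp
    rw [← HahnSeries.single_neg]
    congr 1
    ring
  | mul P Q hP hQ =>
    rw [map_mul, euler_mul, hP, hQ, annihilationFock_mul, map_add, annihilationExpSum_smul,
      annihilationExpSum_smul]
    ring
  | add P Q hP hQ => simp only [map_add, hP, hQ]

end VertexIota

/-! ### The operator `L(-1)` and the derivative property. -/

section Translation

variable {L : Type*} [AddCommGroup L] {Λ : EvenLattice L} {G : Type*} [Group G]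
  (E : CentralExtension Λ G)

theorem cform_tmul (α β : L) : cform Λ (1 ⊗ₜ α) (1 ⊗ₜ β) = (Λ.form α β : ℂ) := by
  simp [cform]

theorem creationSeries_single_zero (h : Cartan L) :
    creationSeries (Finsupp.single 0 h) =
      HahnSeries.ofPowerSeries ℤ (Fock L) (creationPart h) := by
  simp [creationSeries, creationPart]

/-- The series `f` with `Y(ι(a), z) (Q ⊗ ι(b)) = f(z) ι(ab)`. -/
def iotaSeries (a b : G) (Q : Fock L) : HahnSeries ℤ (Fock L) :=
  HahnSeries.single (Λ.form (bar E a) (bar E b)) 1 *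
    HahnSeries.ofPowerSeries ℤ (Fock L) (expSeries (cbar E a)) * annihilationExp E a Q

theorem vertexIota_apply (a b : G) (Q : Fock L) :
    vertexIota E a (Q ⊗ₜ tw E b) = seriesAction (Fock L) (VL E) (iotaSeries E a b Q)
      (constSeries (VL E) (iota E (a * b))) :=
  vertexIota_tmul E a b Q

/-- The three summands are the derivatives of the three factors of `Y(ι(a), z)`: the power of `z`
gives the zero mode, the two exponentials give the creation and the annihilation modes of `ā(z)`. -/
theorem euler_iotaSeries (a b : G) (Q : Fock L) (N : ℕ)
    (hN : ∀ j, N ≤ j → annihilationFock Λ (cbar E a) Q j = 0) :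
    euler (iotaSeries E a b Q) = HahnSeries.C (Λ.form (bar E a) (bar E b) : Fock L) *
        iotaSeries E a b Q +
      HahnSeries.single 1 1 * (HahnSeries.ofPowerSeries ℤ (Fock L) (creationPart (cbar E a)) *
        iotaSeries E a b Q) +
      ∑ j ∈ Finset.range N, HahnSeries.single (-(j : ℤ)) 1 *
        iotaSeries E a b (annihilationFock Λ (cbar E a) Q j) := by
  have h1 : annihilationExpSum E a (annihilationFock Λ (cbar E a) Q) =
      ∑ j ∈ Finset.range N, HahnSeries.single (-(j : ℤ)) 1 *
        annihilationExp E a (annihilationFock Λ (cbar E a) Q j) := by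
    rw [annihilationExpSum, Finsupp.liftAddHom_apply, Finsupp.sum_of_support_subset]
    · rfl
    · intro j hj
      rw [Finset.mem_range]
      by_contra hc
      exact Finsupp.mem_support_iff.1 hj (hN j (not_lt.1 hc))
    · simp
  have h2 : euler (HahnSeries.single (Λ.form (bar E a) (bar E b)) (1 : Fock L)) =
      HahnSeries.C (Λ.form (bar E a) (bar E b) : Fock L) *
        HahnSeries.single (Λ.form (bar E a) (bar E b)) 1 := by
    rw [euler_single]
    change _ = HahnSeries.single 0 _ * _
    rw [HahnSeries.single_mul_single, zero_add]
  simp only [iotaSeries]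
  rw [euler_mul, euler_mul, euler_annihilationExp, h1, h2, euler_ofPowerSeries,
    derivative_expSeries, map_mul, Finset.mul_sum]
  congr 1
  · ring
  · exact Finset.sum_congr rfl fun j _ => by ring

theorem annihilation_eq_zero_of_fock (h : Cartan L) (Q : Fock L) (b : G) (N : ℕ)
    (hN : ∀ j, N ≤ j → annihilationFock Λ h Q j = 0) (j : ℕ) (hj : N + 1 ≤ j) :
    annihilation E h (Q ⊗ₜ tw E b) j = 0 := by
  rw [annihilation_tmul, hN j (by omega), if_neg (by omega)]
  simp

theorem exists_annihilationFock_eq_zero (h : Cartan L) (Q : Fock L) :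
    ∃ N : ℕ, ∀ j, N ≤ j → annihilationFock Λ h Q j = 0 := by
  obtain ⟨N, hN⟩ := Finset.exists_nat_subset_range (annihilationFock Λ h Q).support
  refine ⟨N, fun j hj => ?_⟩
  by_contra hc
  exact absurd (Finset.mem_range.1 (hN (Finsupp.mem_support_iff.2 hc))) (not_lt.2 hj)

/-- Each factor of `Y(ι(a), z)` has a part of `ā(z)` as logarithmic derivative, and the order of the
factors is the normal order. This is the case `u = ι(a)` of the derivative property, with `L(-1)ι(a)
= ā(-1)ι(a)`. -/
theorem isDeriv_vertexIota (a : G) :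
    IsDeriv E (vertexIota E a) (normalOrder E (Finsupp.single 0 (cbar E a)) (vertexIota E a)) := by
  intro v n
  have key : co n ∘ₗ normalOrder E (Finsupp.single 0 (cbar E a)) (vertexIota E a) =
      ((n : ℂ) + 1) • (co (n + 1) ∘ₗ vertexIota E a) := by
    apply VL_ext
    intro Q b
    obtain ⟨N, hN⟩ := exists_annihilationFock_eq_zero (Λ := Λ) (cbar E a) Q
    have hN' : ∀ j, N + 1 ≤ j → annihilationFock Λ (cbar E a) Q j = 0 := fun j hj =>
      hN j (by omega)
    rw [LinearMap.comp_apply, LinearMap.smul_apply, LinearMap.comp_apply,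
      normalOrder_single E 0 (N + 1) _ _ _ (annihilation_eq_zero_of_fock E _ Q b N hN),
      creationSeries_single_zero]
    have hm : (Λ.form (bar E a) (bar E b) : Fock L) =
        algebraMap ℂ (Fock L) (Λ.form (bar E a) (bar E b) : ℂ) := by simp
    -- The exponent is `n + 1` because `z d/dz` shifts exponents by one against `d/dz`.
    have h1 := congrArg (fun f => HahnSeries.coeff f (n + 1)) (euler_iotaSeries E a b Q (N + 1) hN')
    simp only [annihilation_tmul, map_add, map_smul, vertexIota_apply, map_sum,
      ← Module.End.mul_apply, ← map_mul, co_seriesAction_constSeries]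
    simp only [cform_tmul]
    simp only [coeff_euler, HahnSeries.coeff_add, HahnSeries.coeff_sum,
      HahnSeries.coeff_single_mul, HahnSeries.C_mul_eq_smul, HahnSeries.coeff_smul, one_mul,
      add_sub_cancel_right] at h1
    have h2 : ((n : ℂ) + 1) • (iotaSeries E a b Q).coeff (n + 1) • iota E (a * b) =
        (((n + 1 : ℤ) : Fock L) * (iotaSeries E a b Q).coeff (n + 1)) • iota E (a * b) := by
      rw [← smul_assoc, Algebra.smul_def]
      simp
    simp only [zero_add, Nat.choose_zero_right, pow_zero, Nat.cast_one, mul_one, one_smul,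
      Nat.cast_zero, neg_zero, HahnSeries.coeff_single_mul, one_mul]
    have h3 : ∑ j ∈ Finset.range (N + 1), (if j = 0 then (Λ.form (bar E a) (bar E b) : ℂ) else 0) •
        (iotaSeries E a b Q).coeff (n - (0 - 1 - (j : ℤ))) • iota E (a * b) =
        ((Λ.form (bar E a) (bar E b) : Fock L) • (iotaSeries E a b Q).coeff (n + 1)) •
          iota E (a * b) := by
      rw [Finset.sum_eq_single_of_mem 0 (by simp)]
      · rw [if_pos rfl, hm, smul_eq_mul, ← Algebra.smul_def, smul_assoc]
        congr 3
      · intro j _ hj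
        rw [if_neg hj, zero_smul]
    have h4 : ∀ j : ℕ, n + 1 - -(j : ℤ) = n - (0 - 1 - j) := fun j => by ring
    rw [h2, h1, add_smul, add_smul, Finset.sum_smul, Finset.sum_add_distrib, h3]
    simp only [h4]
    abel
  exact LinearMap.congr_fun key v

/-- The operator `P ⊗ ι(a) ↦ ā(-1) P ⊗ ι(a)`. -/
def barCreation : VL E →ₗ[ℂ] VL E :=
  TensorProduct.lift (LinearMap.flip (twLift E
    (fun a => (TensorProduct.mk ℂ (Fock L) (TwistedGroupAlgebra E)).flip (tw E a) ∘ₗ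
      LinearMap.mulLeft ℂ (creation 0 (cbar E a)))
    (fun a => by
      apply LinearMap.ext
      intro Q
      simp [cbar, bar_neg_mul, tw_neg])))

theorem barCreation_tmul (P : Fock L) (a : G) :
    barCreation E (P ⊗ₜ tw E a) = (creation 0 (cbar E a) * P) ⊗ₜ tw E a := by
  simp [barCreation, twLift_tw]

/-- The operator `L(-1)` of `V_L`. -/
def translate : VL E →ₗ[ℂ] VL E :=
  Fock.translation.rTensor (TwistedGroupAlgebra E) + barCreation E

theorem translate_tmul (P : Fock L) (a : G) :
    translate E (P ⊗ₜ tw E a) =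
      (Fock.translation P + creation 0 (cbar E a) * P) ⊗ₜ tw E a := by
  rw [translate, LinearMap.add_apply, barCreation_tmul, LinearMap.rTensor_tmul,
    TensorProduct.add_tmul]

theorem Y_tmul (P : Fock L) (a : G) :
    Y E (P ⊗ₜ tw E a) = normalOrderFock E P (vertexIota E a) := by
  simp [Y, vertexTw, twLift_tw]

/-- The derivative property `Y(L(-1) u, z) = d/dz Y(u, z)`. -/
theorem isDeriv_Y_translate (u : VL E) : IsDeriv E (Y E u) (Y E (translate E u)) := by
  intro v n
  have key : co n ∘ₗ (LinearMap.applyₗ v) ∘ₗ Y E ∘ₗ translate E =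
      ((n : ℂ) + 1) • (co (n + 1) ∘ₗ LinearMap.applyₗ v ∘ₗ Y E) := by
    apply VL_ext
    intro P a
    have h := (isDeriv_vertexIota E a).normalOrderFock E P v n
    simp only [LinearMap.comp_apply, LinearMap.smul_apply, LinearMap.applyₗ_apply_apply]
    rw [translate_tmul, Y_tmul, Y_tmul, map_add, ← h, mul_comm, map_mul, ← Fock.gen_single,
      LinearMap.add_apply, Module.End.mul_apply]
    congr 4
    rw [normalOrderFock, Fock.lift_gen]
  exact LinearMap.congr_fun key u

end Translation

/-! ### The action of `L(0)` and the weights of the vectors used. -/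

section Weight

variable {L : Type*} [AddCommGroup L] {Λ : EvenLattice L} {G : Type*} [Group G]
  (E : CentralExtension Λ G)

theorem bar_one : bar E 1 = 0 := by simp [bar]

theorem bar_mul (a b : G) : bar E (a * b) = bar E a + bar E b := by simp [bar]

theorem bar_inv (a : G) : bar E a⁻¹ = - bar E a := by simp [bar]

theorem cbar_one : cbar E 1 = 0 := by rw [cbar, bar_one, TensorProduct.tmul_zero]

theorem expSeries_zero : expSeries (0 : Cartan L) = 1 := by
  have h : creationExponent (0 : Cartan L) = 0 := by
    ext n
    simp [creationExponent]
  rw [expSeries, h]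
  ext n
  rw [PowerSeries.coeff_subst' PowerSeries.HasSubst.zero', finsum_eq_single _ 0]
  · simp
  · intro d hd
    simp [zero_pow hd]

theorem annihilationExp_one (Q : Fock L) : annihilationExp E 1 Q = HahnSeries.C Q := by
  induction Q using Fock.induction_creation with
  | algebraMap r => rw [annihilationExp_algebraMap]
  | creation n h => rw [annihilationExp_creation, cbar_one]; simp
  | mul P Q hP hQ => rw [map_mul, hP, hQ, map_mul]
  | add P Q hP hQ => rw [map_add, hP, hQ, map_add]

theorem co_vertexIota_one (n : ℤ) (w : VL E) :
    co n (vertexIota E 1 w) = if n = 0 then w else 0 := by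
  have key : co n ∘ₗ vertexIota E 1 = (if n = 0 then (1 : ℂ) else 0) • LinearMap.id := by
    apply VL_ext
    intro Q b
    rw [LinearMap.comp_apply, vertexIota_apply, co_seriesAction_constSeries, iotaSeries,
      annihilationExp_one, cbar_one, expSeries_zero, bar_one, map_zero, LinearMap.zero_apply,
      HahnSeries.single_zero_one, map_one, one_mul, one_mul, one_mul]
    change (HahnSeries.single 0 Q).coeff n • _ = _
    rw [HahnSeries.coeff_single]
    split_ifs
    · simp [iota, TensorProduct.smul_tmul']
    · simp
  have := LinearMap.congr_fun key w
  rw [LinearMap.comp_apply] at this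
  rw [this]
  split_ifs <;> simp

/-- The vertex operator `h(z) = ∑ h(n) z^(-n-1)`. -/
def heisenberg (h : Cartan L) : VertexOperator ℂ (VL E) :=
  normalOrder E (Finsupp.single 0 h) (vertexIota E 1)

theorem co_heisenberg_natCast (h : Cartan L) (k : ℕ) (w : VL E) :
    co (k : ℤ) (heisenberg E h w) = creation k h • w := by
  obtain ⟨N, hN⟩ := exists_annihilation_eq_zero E h w
  rw [heisenberg, co_normalOrder_single E 0 h _ w k (k + 1) N (fun j hj => by
    rw [co_vertexIota_one, if_neg (by omega)]) hN]
  rw [Finset.sum_eq_single_of_mem k (by simp), Finset.sum_eq_zero, add_zero, co_vertexIota_one,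
    if_pos (by ring)]
  · simp
  · intro j _
    rw [co_vertexIota_one, if_neg (by push_cast; omega), smul_zero]
  · intro j _ hj
    rw [co_vertexIota_one, if_neg (by omega), smul_zero, smul_zero]

theorem co_heisenberg_neg (h : Cartan L) (k : ℕ) (w : VL E) :
    co (-(k : ℤ) - 1) (heisenberg E h w) = annihilation E h w k := by
  obtain ⟨N, hN⟩ := exists_annihilation_eq_zero E h w
  rw [heisenberg, co_normalOrder_single E 0 h _ w _ 0 (N + k + 1) (fun j hj => by
    rw [co_vertexIota_one, if_neg (by omega)]) (fun j hj => hN j (by omega))]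
  rw [Finset.range_zero, Finset.sum_empty, zero_add,
    Finset.sum_eq_single_of_mem k (by simp), co_vertexIota_one, if_pos (by push_cast; ring)]
  · simp
  · intro j _ hj
    rw [co_vertexIota_one, if_neg (by push_cast; omega), smul_zero]

/-- The terms `h(-j)h(j)`, `j > 0`, occur twice, once from the creation part of the outer factor and
once from its annihilation part; `h(0)^2` occurs once. -/
theorem co_normalOrder_heisenberg (h : Cartan L) (v : VL E) (N : ℕ)
    (hN : ∀ j, N ≤ j → annihilation E h v j = 0) :
    co (-2) (normalOrder E (Finsupp.single 0 h) (heisenberg E h) v) =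
      annihilation E h (annihilation E h v 0) 0 +
        (2 : ℂ) • ∑ j ∈ Finset.range N, creation j h • annihilation E h v (j + 1) := by
  have h1 : ∀ j : ℕ, (-2 : ℤ) - j = -((j + 1 : ℕ) : ℤ) - 1 := fun j => by push_cast; ring
  rw [co_normalOrder_single E 0 h _ v (-2) N (N + 1) (fun j hj => by
    rw [h1, co_heisenberg_neg, hN _ (by omega)]) (fun j hj => hN j (by omega))]
  rw [Finset.sum_range_succ', show (-2 : ℤ) + (0 : ℕ) + 1 + (0 : ℕ) = -((0 : ℕ) : ℤ) - 1 by simp,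
    co_heisenberg_neg]
  have h2 : ∀ j : ℕ, (-2 : ℤ) + (0 : ℕ) + 1 + (j + 1 : ℕ) = j := fun j => by push_cast; ring
  simp only [h1, h2, co_heisenberg_neg, co_heisenberg_natCast]
  simp only [zero_add, Nat.choose_zero_right, pow_zero, Nat.cast_one, mul_one, one_smul, two_smul]
  abel

/-- `(w_j)_j ↦ ∑_{j > 0} h(-j) w_j`. -/
def creationSum (h : Cartan L) : (ℕ →₀ Fock L) →ₗ[Fock L] Fock L :=
  Finsupp.linearCombination (Fock L) fun j => creation (j - 1) h

theorem creationSum_annihilationFock (h : Cartan L) (P : Fock L) (N : ℕ)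
    (hN : ∀ j, N ≤ j → annihilationFock Λ h P j = 0) :
    creationSum h (annihilationFock Λ h P) =
      ∑ j ∈ Finset.range N, creation j h * annihilationFock Λ h P (j + 1) := by
  rw [creationSum, Finsupp.linearCombination_apply,
    Finsupp.sum_of_support_subset (s := Finset.range (N + 1))]
  · rw [Finset.sum_range_succ']
    simp [annihilationFock_zero_apply, mul_comm]
  · intro j hj
    rw [Finset.mem_range]
    by_contra hc
    exact Finsupp.mem_support_iff.1 hj (hN j (by omega))
  · simp

variable [Module.Free ℤ L] [Module.Finite ℤ L]

variable (Λ) in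
theorem sum_cform_smul_orthonormalBasis (h : Cartan L) :
    ∑ i, cform Λ (orthonormalBasis Λ i) h • orthonormalBasis Λ i = h := by
  have h1 := (exists_orthonormalBasis Λ).choose_spec
  conv_rhs => rw [← (orthonormalBasis Λ).sum_repr h]
  refine Finset.sum_congr rfl fun i _ => ?_
  congr 1
  conv_lhs => rw [← (orthonormalBasis Λ).sum_repr h]
  simp only [map_sum, map_smul, smul_eq_mul]
  rw [Finset.sum_eq_single i]
  · rw [orthonormalBasis, h1]
    simp
  · intro j _ hj
    rw [orthonormalBasis, h1, if_neg hj.symm, mul_zero]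
  · simp

-- For fixed `h`, the operator `∑ h(-j)h(j)` is a derivation of `M(1)`, being first order in the
-- contractions. So the sum over the basis need only be compared with the degree on generators,
-- where orthonormality is used.
variable (Λ) in
theorem sum_creationSum_annihilationFock (P : Fock L) :
    ∑ i, creationSum (orthonormalBasis Λ i) (annihilationFock Λ (orthonormalBasis Λ i) P) =
      Fock.degree P := by
  induction P using Fock.induction_creation with
  | algebraMap r => simp [annihilationFock_algebraMap, Fock.degree, Fock.derivation_algebraMap]
  | creation n h =>
    have h1 : ∀ α, annihilationFock Λ α (creation n h) = Finsupp.single (n + 1)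
        (algebraMap ℂ (Fock L) ((n + 1) * cform Λ α h)) := by
      intro α
      ext i
      rw [annihilationFock_creation, Finsupp.single_apply]
    rw [Fock.degree_creation]
    conv_rhs => rw [← sum_cform_smul_orthonormalBasis Λ h]
    rw [map_sum, Finset.smul_sum]
    refine Finset.sum_congr rfl fun i _ => ?_
    rw [h1, creationSum, Finsupp.linearCombination_single, algebraMap_smul, Nat.add_sub_cancel,
      map_smul, smul_smul]
  | mul a b ha hb =>
    rw [Fock.degree, Fock.derivation_mul, ← Fock.degree, ← ha, ← hb, Finset.mul_sum,
      Finset.mul_sum, ← Finset.sum_add_distrib]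
    refine Finset.sum_congr rfl fun i _ => ?_
    rw [annihilationFock_mul, map_add, map_smul, map_smul, smul_eq_mul, smul_eq_mul]
  | add a b ha hb => simp only [map_add, Finset.sum_add_distrib, ha, hb]

/-- The action of `L(0)`. -/
theorem ncoeff_omega_tmul (P : Fock L) (a : G) :
    VertexOperator.ncoeff (Y E (omega E)) 1 (P ⊗ₜ tw E a) =
      (Fock.degree P + ((Λ.form (bar E a) (bar E a) : ℂ) / 2) • P) ⊗ₜ tw E a := by
  have h0 : VertexOperator.ncoeff (Y E (omega E)) 1 (P ⊗ₜ tw E a) =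
      co (-2) (Y E (omega E) (P ⊗ₜ tw E a)) := rfl
  have h1 : Y E (omega E) = (1 / 2 : ℂ) • ∑ i,
      normalOrder E (Finsupp.single 0 (orthonormalBasis Λ i))
        (heisenberg E (orthonormalBasis Λ i)) := by
    rw [omega, map_smul, map_sum]
    congr 1
    refine Finset.sum_congr rfl fun i _ => ?_
    rw [Y_tmul, pow_two, map_mul, Module.End.mul_apply, ← Fock.gen_single, normalOrderFock,
      Fock.lift_gen, heisenberg]
  have h2 : ∀ h : Cartan L, co (-2) (normalOrder E (Finsupp.single 0 h) (heisenberg E h)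
      (P ⊗ₜ tw E a)) = ((cform Λ h (cbar E a) * cform Λ h (cbar E a)) • P +
        (2 : ℂ) • creationSum h (annihilationFock Λ h P)) ⊗ₜ tw E a := by
    intro h
    obtain ⟨N, hN⟩ := exists_annihilationFock_eq_zero (Λ := Λ) h P
    rw [co_normalOrder_heisenberg E h _ (N + 1) (annihilation_eq_zero_of_fock E h P a N hN),
      creationSum_annihilationFock h P (N + 1) (fun j hj => hN j (by omega)),
      TensorProduct.add_tmul]
    simp only [annihilation_tmul, annihilationFock_zero_apply, map_smul, if_true,
      TensorProduct.zero_tmul, zero_add, Finsupp.smul_apply, smul_smul]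
    congr 1
    simp [TensorProduct.smul_tmul', TensorProduct.sum_tmul, Finset.smul_sum]
  have h3 : ∑ i, cform Λ (orthonormalBasis Λ i) (cbar E a) *
      cform Λ (orthonormalBasis Λ i) (cbar E a) = (Λ.form (bar E a) (bar E a) : ℂ) := by
    have h4 := congrArg (fun y => cform Λ y (cbar E a))
      (sum_cform_smul_orthonormalBasis Λ (cbar E a))
    simp only [map_sum, map_smul, LinearMap.sum_apply, LinearMap.smul_apply, smul_eq_mul] at h4
    rw [h4, cform_tmul]
  rw [h0, h1, LinearMap.smul_apply, map_smul, LinearMap.sum_apply, map_sum]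
  simp only [h2]
  rw [← TensorProduct.sum_tmul, Finset.sum_add_distrib, ← Finset.sum_smul, h3, ← Finset.smul_sum,
    sum_creationSum_annihilationFock, TensorProduct.smul_tmul', smul_add, smul_smul, smul_smul,
    add_comm]
  congr 2
  · norm_num
  · congr 1
    ring

/-- This is `[L(0), L(-1)] = L(-1)`: both the translation of `M(1)` and multiplication by `ā(-1)`
raise the degree by one and leave the lattice element alone. -/
theorem ncoeff_omega_translate (u : VL E) :
    VertexOperator.ncoeff (Y E (omega E)) 1 (translate E u) =
      translate E (VertexOperator.ncoeff (Y E (omega E)) 1 u) + translate E u := by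
  have key : VertexOperator.ncoeff (Y E (omega E)) 1 ∘ₗ translate E =
      translate E ∘ₗ VertexOperator.ncoeff (Y E (omega E)) 1 + translate E := by
    apply VL_ext
    intro P a
    simp only [LinearMap.comp_apply, LinearMap.add_apply, translate_tmul, ncoeff_omega_tmul,
      ← TensorProduct.add_tmul]
    congr 1
    have h1 : ∀ P Q : Fock L, Fock.degree (P * Q) = P * Fock.degree Q + Q * Fock.degree P :=
      Fock.derivation_mul _
    simp only [map_add, Fock.degree_translation, h1, Fock.degree_creation, map_smul, smul_add,
      mul_add, mul_smul_comm]
    simp [mul_comm]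
    abel
  exact LinearMap.congr_fun key u

theorem translate_mem_weightSpace {n : ℤ} {u : VL E}
    (hu : u ∈ TwistedZhu.weightSpace (Y E) (omega E) n) :
    translate E u ∈ TwistedZhu.weightSpace (Y E) (omega E) (n + 1) := by
  rw [TwistedZhu.weightSpace, Module.End.mem_eigenspace_iff] at *
  rw [ncoeff_omega_translate, hu, map_smul, Int.cast_add, Int.cast_one, add_smul, one_smul]

theorem creation_mem_weightSpace (n : ℕ) (h : Cartan L) :
    creation n h ⊗ₜ tw E 1 ∈ TwistedZhu.weightSpace (Y E) (omega E) (n + 1) := by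
  rw [TwistedZhu.weightSpace, Module.End.mem_eigenspace_iff, ncoeff_omega_tmul, bar_one,
    Fock.degree_creation]
  simp [TensorProduct.smul_tmul']

theorem iota_mem_weightSpace (a : G) (n : ℤ) (hn : Λ.form (bar E a) (bar E a) = 2 * n) :
    iota E a ∈ TwistedZhu.weightSpace (Y E) (omega E) n := by
  rw [TwistedZhu.weightSpace, Module.End.mem_eigenspace_iff, iota, ncoeff_omega_tmul, hn,
    Fock.degree, Fock.derivation_one, zero_add, TensorProduct.smul_tmul']
  congr 2
  push_cast
  ring

end Weight

/-! ### Relations from odd vectors, and the reduction to the vectors `ι(a)`. -/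

section Zhu

variable {L : Type*} [AddCommGroup L] {Λ : EvenLattice L} {G : Type*} [Group G]
  (E : CentralExtension Λ G) (θ : G ≃* G) (hθ : ∀ a, bar E (θ a) = - bar E a)

/-- The automorphism of `M(1)` with `h(-n) ↦ -h(-n)`. -/
def Fock.negate : Fock L →ₐ[ℂ] Fock L := Fock.lift (-Fock.gen) (fun _ _ => mul_comm _ _)

theorem Fock.negate_creation (n : ℕ) (h : Cartan L) :
    Fock.negate (creation n h) = - creation n h := by
  rw [Fock.negate, ← Fock.gen_single, Fock.lift_gen, LinearMap.neg_apply]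

theorem Fock.translation_negate (P : Fock L) :
    Fock.translation (Fock.negate P) = Fock.negate (Fock.translation P) := by
  induction P using Fock.induction_creation with
  | algebraMap r =>
    rw [AlgHom.commutes, Fock.translation, Fock.derivation_algebraMap, map_zero]
  | creation n h =>
    rw [Fock.negate_creation, map_neg, Fock.translation_creation, map_smul, Fock.negate_creation,
      smul_neg]
  | mul a b ha hb =>
    have h2 : ∀ P Q : Fock L, Fock.translation (P * Q) =
      P * Fock.translation Q + Q * Fock.translation P := Fock.derivation_mul _
    simp only [h2, map_mul, map_add, ha, hb]
  | add a b ha hb => simp only [map_add, ha, hb]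

theorem thetaMap_tmul (P : Fock L) (a : G) :
    thetaMap E θ hθ (P ⊗ₜ tw E a) = Fock.negate P ⊗ₜ tw E (θ a) := by
  rw [thetaMap, TensorProduct.map_tmul, twLift_tw]
  rfl

theorem thetaMap_translate (u : VL E) :
    thetaMap E θ hθ (translate E u) = translate E (thetaMap E θ hθ u) := by
  have key : thetaMap E θ hθ ∘ₗ translate E = translate E ∘ₗ thetaMap E θ hθ := by
    apply VL_ext
    intro P a
    simp only [LinearMap.comp_apply, translate_tmul, thetaMap_tmul, map_add, map_mul,
      Fock.translation_negate, Fock.negate_creation, cbar, hθ, TensorProduct.tmul_neg, map_neg]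
  exact LinearMap.congr_fun key u

theorem mem_sector_one {V : Type*} [AddCommGroup V] [Module ℂ V] (g : V →ₗ[ℂ] V) (u : V)
    (hu : g u = -u) : u ∈ TwistedZhu.sector g 2 1 := by
  rw [TwistedZhu.sector, Module.End.mem_eigenspace_iff, hu,
    show -2 * (Real.pi : ℂ) * Complex.I * (1 : ℕ) / (2 : ℕ) = -(Real.pi * Complex.I) by
      push_cast; ring, Complex.exp_neg, Complex.exp_pi_mul_I]
  simp

theorem Y_creation_zero (h : Cartan L) : Y E (creation 0 h ⊗ₜ tw E 1) = heisenberg E h := by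
  rw [Y_tmul, ← Fock.gen_single, normalOrderFock, Fock.lift_gen, heisenberg]

/-- The polynomials of degree at most one in `M(1)`. -/
def Fock.linearPart (L : Type*) [AddCommGroup L] : Submodule ℂ (Fock L) :=
  LinearMap.range Fock.gen ⊔ 1

theorem Fock.one_le_linearPart : (1 : Submodule ℂ (Fock L)) ≤ Fock.linearPart L := le_sup_right

theorem Fock.linearPart_pow_mono {m n : ℕ} (h : m ≤ n) :
    Fock.linearPart L ^ m ≤ Fock.linearPart L ^ n :=
  pow_le_pow_right₀ Fock.one_le_linearPart h

theorem Fock.exists_mem_linearPart_pow (P : Fock L) : ∃ d, P ∈ Fock.linearPart L ^ d := by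
  induction P using Fock.induction with
  | algebraMap r => exact ⟨0, by rw [pow_zero]; exact Submodule.algebraMap_mem r⟩
  | gen x => exact ⟨1, by rw [pow_one]; exact Submodule.mem_sup_left ⟨x, rfl⟩⟩
  | mul a b ha hb =>
    obtain ⟨m, hm⟩ := ha
    obtain ⟨n, hn⟩ := hb
    exact ⟨m + n, by rw [pow_add]; exact Submodule.mul_mem_mul hm hn⟩
  | add a b ha hb =>
    obtain ⟨m, hm⟩ := ha
    obtain ⟨n, hn⟩ := hb
    exact ⟨max m n, Submodule.add_mem _ (Fock.linearPart_pow_mono (le_max_left _ _) hm)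
      (Fock.linearPart_pow_mono (le_max_right _ _) hn)⟩

variable (Λ) in
theorem annihilationFock_gen_mem_one (h : Cartan L) (x : ℕ →₀ Cartan L) (i : ℕ) :
    annihilationFock Λ h (Fock.gen x) i ∈ (1 : Submodule ℂ (Fock L)) := by
  induction x using Finsupp.induction_linear with
  | zero => simp
  | add x y hx hy => rw [map_add, map_add, Finsupp.add_apply]; exact Submodule.add_mem _ hx hy
  | single n α =>
    rw [Fock.gen_single, annihilationFock_creation]
    split_ifs
    · exact Submodule.algebraMap_mem _
    · exact Submodule.zero_mem _

-- In the Leibniz rule a factor of degree at most one contracts to a scalar, so the degree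
-- filtration is preserved. This lets the terms `h(i)v` fall under the induction on degree.
variable (Λ) in
theorem annihilationFock_mem_linearPart_pow (h : Cartan L) (i d : ℕ) (P : Fock L)
    (hP : P ∈ Fock.linearPart L ^ d) : annihilationFock Λ h P i ∈ Fock.linearPart L ^ d := by
  induction d generalizing P with
  | zero =>
    rw [pow_zero] at *
    obtain ⟨c, rfl⟩ := Submodule.mem_one.1 hP
    rw [annihilationFock_algebraMap]
    exact Submodule.zero_mem _
  | succ d ih =>
    rw [pow_succ'] at hP
    induction hP using Submodule.mul_induction_on' with
    | mem_mul_mem x hx y hy =>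
      rw [annihilationFock_mul_apply]
      refine Submodule.add_mem _ ?_ ?_
      · rw [pow_succ']
        exact Submodule.mul_mem_mul hx (ih y hy)
      · obtain ⟨_, ⟨z, rfl⟩, w, hw, rfl⟩ := Submodule.mem_sup.1 hx
        obtain ⟨c, rfl⟩ := Submodule.mem_one.1 hw
        rw [map_add, annihilationFock_algebraMap, add_zero]
        obtain ⟨e, he⟩ := Submodule.mem_one.1 (annihilationFock_gen_mem_one Λ h z i)
        rw [← he, mul_comm, ← Algebra.smul_def]
        exact Submodule.smul_mem _ _ (Fock.linearPart_pow_mono (Nat.le_succ d) hy)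
    | add x _ y _ hx hy => rw [map_add, Finsupp.add_apply]; exact Submodule.add_mem _ hx hy

theorem residue_Y_iota (s : ℂ) (a b : G) (p q : ℕ)
    (h : (p : ℤ) = Λ.form (bar E a) (bar E b) + q) :
    TwistedZhu.residue s (1 + p) (Y E (iota E a) (iota E b)) =
      ∑ j ∈ Finset.range (q + 1), Ring.choose s j • (schur (cbar E a) (q - j) ⊗ₜ tw E (a * b)) := by
  have h1 : ∀ n, co n (Y E (iota E a) (iota E b)) =
      (HahnSeries.ofPowerSeries ℤ (Fock L) (expSeries (cbar E a))).coeff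
        (n - Λ.form (bar E a) (bar E b)) • iota E (a * b) := by
    intro n
    rw [iota, Y_tmul, map_one, Module.End.one_apply, iota, vertexIota_apply,
      co_seriesAction_constSeries, iotaSeries, map_one (annihilationExp E a), mul_one,
      HahnSeries.coeff_single_mul, one_mul]
  rw [residue_eq_sum _ _ _ (q + 1) (fun j hj => by
    rw [h1, coeff_ofPowerSeries_of_neg _ (by omega), zero_smul])]
  refine Finset.sum_congr rfl fun j hj => ?_
  rw [Finset.mem_range] at hj
  rw [h1, show (1 + p - 1 - (j : ℤ) - Λ.form (bar E a) (bar E b) : ℤ) = ((q - j : ℕ) : ℤ) by omega,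
    coeff_ofPowerSeries_natCast, iota, TensorProduct.smul_tmul', smul_eq_mul, mul_one]
  rfl

variable [Module.Free ℤ L] [Module.Finite ℤ L]

/-- The space `O_θ(V_L)`. -/
abbrev zhuO : Submodule ℂ (VL E) := TwistedZhu.O (Y E) (omega E) (thetaMap E θ hθ) 2

/-- Induction on `p`. The relation for `L(-1)u`, which is odd of weight `n + 1`, integrates by parts
into a combination of the relations for `u` with pole orders `p + 1` and `p + 2`; the latter has the
invertible coefficient `p + 1`. -/
theorem residue_mem_zhuO (p : ℕ) (n : ℤ) (u v : VL E) (hu : thetaMap E θ hθ u = -u)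
    (hn : u ∈ TwistedZhu.weightSpace (Y E) (omega E) n) :
    TwistedZhu.residue ((n : ℂ) - 1 / 2) (1 + p) (Y E u v) ∈ zhuO E θ hθ := by
  induction p generalizing n u with
  | zero =>
    -- For `r = 1` and `T = 2` one has `δ_r = 0`, so the exponents are `n - 1/2` and `1`.
    refine Submodule.subset_span ⟨1, n, u, v, by norm_num, mem_sector_one _ u hu, hn, ?_⟩
    rw [TwistedZhu.circ]
    congr 1
    simp only [TwistedZhu.delta]
    norm_num
    ring
  | succ p ih =>
    have h1 := ih (n + 1) (translate E u) (by rw [thetaMap_translate, hu, map_neg])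
      (translate_mem_weightSpace E hn)
    have h2 := residue_deriv ((n : ℂ) - 1 / 2) p (Y E u v) (Y E (translate E u) v)
      (isDeriv_Y_translate E u v)
    rw [show ((n + 1 : ℤ) : ℂ) - 1 / 2 = n - 1 / 2 + 1 by push_cast; ring, h2] at h1
    have h3 := (Submodule.add_mem_iff_left _ (Submodule.smul_mem _ _ (ih n u hu hn))).1 h1
    have h4 := (Submodule.smul_mem_iff _ (Nat.cast_add_one_ne_zero p)).1 h3
    convert h4 using 2
    push_cast
    ring

/-- The odd vector is `h(-1)1`, of weight one, so the power of `1 + z` is `1/2`. The first sum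
collects the creation modes and the second the modes `h(i)`, `i ≥ 0`. The leading coefficient
`binom(1/2, 0)` is one, so `h(-p-1)v` can be solved for. -/
theorem heisenberg_relation (h : Cartan L) (p : ℕ) (v : VL E) (N : ℕ)
    (hN : ∀ j, N ≤ j → annihilation E h v j = 0) :
    ∑ j ∈ Finset.range (p + 1), Ring.choose (1 / 2 : ℂ) j • creation (p - j) h • v +
      ∑ i ∈ Finset.range N, Ring.choose (1 / 2 : ℂ) (p + 1 + i) • annihilation E h v i ∈
        zhuO E θ hθ := by
  have h1 := residue_mem_zhuO E θ hθ p ((0 : ℕ) + 1) (creation 0 h ⊗ₜ tw E 1) v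
    (by rw [thetaMap_tmul, Fock.negate_creation, map_one, TensorProduct.neg_tmul])
    (creation_mem_weightSpace E 0 h)
  have h2 : ∀ i : ℕ, (1 + p - 1 - ((p + 1 + i : ℕ) : ℤ) : ℤ) = -i - 1 := fun i => by
    push_cast; ring
  rw [Y_creation_zero, residue_eq_sum _ _ _ (p + 1 + N) (fun j hj => by
    obtain ⟨i, rfl⟩ := Nat.exists_eq_add_of_le (le_of_add_le_left hj : p + 1 ≤ j)
    rw [h2, co_heisenberg_neg, hN i (by omega)]), Finset.sum_range_add] at h1
  convert h1 using 2
  · refine Finset.sum_congr rfl fun j hj => ?_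
    rw [Finset.mem_range] at hj
    rw [show (1 + p - 1 - (j : ℤ) : ℤ) = ((p - j : ℕ) : ℤ) by omega, co_heisenberg_natCast]
    congr 2
    norm_num
  · refine Finset.sum_congr rfl fun i _ => ?_
    rw [h2, co_heisenberg_neg]
    congr 2
    norm_num

/-- Modulo `O_θ(V_L)`, the space `V_L` is spanned by the vectors `ι(a)`. -/
theorem zhuO_sup_span_iota : zhuO E θ hθ ⊔ Submodule.span ℂ (Set.range (iota E)) = ⊤ := by
  set T := zhuO E θ hθ ⊔ Submodule.span ℂ (Set.range (iota E)) with hT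
  -- Outer induction on the degree filtration, inner strong induction on the mode `n` of the leading
  -- factor `h(-n-1)`.
  have main : ∀ (d : ℕ) (P : Fock L), P ∈ Fock.linearPart L ^ d → ∀ a, P ⊗ₜ tw E a ∈ T := by
    intro d
    induction d with
    | zero =>
      intro P hP a
      rw [pow_zero] at hP
      obtain ⟨c, rfl⟩ := Submodule.mem_one.1 hP
      rw [Algebra.algebraMap_eq_smul_one, ← TensorProduct.smul_tmul']
      exact Submodule.smul_mem _ _ (Submodule.mem_sup_right (Submodule.subset_span ⟨a, rfl⟩))
    | succ d ih =>
      intro P hP a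
      rw [pow_succ'] at hP
      induction hP using Submodule.mul_induction_on' with
      | mem_mul_mem x hx Q hQ =>
        obtain ⟨_, ⟨z, rfl⟩, w, hw, rfl⟩ := Submodule.mem_sup.1 hx
        obtain ⟨c, rfl⟩ := Submodule.mem_one.1 hw
        rw [add_mul, TensorProduct.add_tmul, ← Algebra.smul_def, ← TensorProduct.smul_tmul']
        refine Submodule.add_mem _ ?_ (Submodule.smul_mem _ _ (ih Q hQ a))
        clear hx
        induction z using Finsupp.induction_linear with
        | zero => simp
        | add x y hx hy =>
          rw [map_add, add_mul, TensorProduct.add_tmul]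
          exact Submodule.add_mem _ hx hy
        | single n h =>
          rw [Fock.gen_single]
          induction n using Nat.strong_induction_on with
          | _ n ihn =>
            obtain ⟨N, hN⟩ := exists_annihilation_eq_zero E h (Q ⊗ₜ tw E a)
            have h1 : _ ∈ T := Submodule.mem_sup_left
              (heisenberg_relation E θ hθ h n (Q ⊗ₜ tw E a) N hN)
            -- The term `j = 0` is the wanted vector `h(-n-1)Q ⊗ ι(a)`. The terms `j > 0` have a
            -- smaller mode, and the terms `h(i)(Q ⊗ ι(a))` stay in filtration degree `d`.
            rw [Submodule.add_mem_iff_left, Finset.sum_range_succ',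
              Submodule.add_mem_iff_right] at h1
            · simpa [TensorProduct.smul_tmul'] using h1
            · refine Submodule.sum_mem _ fun j hj => Submodule.smul_mem _ _ ?_
              rw [TensorProduct.smul_tmul']
              rw [Finset.mem_range] at hj
              exact ihn _ (by omega)
            · refine Submodule.sum_mem _ fun i _ => Submodule.smul_mem _ _ ?_
              rw [annihilation_tmul]
              exact Submodule.add_mem _
                (ih _ (annihilationFock_mem_linearPart_pow Λ h i d Q hQ) a)
                (Submodule.smul_mem _ _ (ih Q hQ a))
      | add x _ y _ hx hy => rw [TensorProduct.add_tmul]; exact Submodule.add_mem _ hx hy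
  rw [← Submodule.ker_mkQ T, LinearMap.ker_eq_top]
  apply VL_ext
  intro P a
  obtain ⟨d, hd⟩ := Fock.exists_mem_linearPart_pow P
  rw [LinearMap.zero_apply, Submodule.mkQ_apply, Submodule.Quotient.mk_eq_zero]
  exact main d P hd a

end Zhu

/-! ### Power series identities for `(1 + z)^(1/2)`. -/

section SquareRoot

open PowerSeries

/-- The power series `(1 + z)^(1/2)`. -/
def sqrtSeries : PowerSeries ℂ := binomialSeries ℂ (1 / 2 : ℂ)

/-- The power series `(1 + z)^(-1/2)`. -/
def invSqrtSeries : PowerSeries ℂ := binomialSeries ℂ (-1 / 2 : ℂ)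

/-- The power series `((1 + z)^(1/2) - 1) / z`. -/
def sqrtQuotient : PowerSeries ℂ := mk fun p => Ring.choose (1 / 2 : ℂ) (p + 1)

theorem sqrtSeries_mul_self : sqrtSeries * sqrtSeries = 1 + X := by
  have h := binomialSeries_nat (R := ℂ) (A := ℂ) 1
  rw [sqrtSeries, ← binomialSeries_add, show (1 / 2 : ℂ) + 1 / 2 = (1 : ℕ) by norm_num, h, pow_one]

theorem invSqrtSeries_mul_sqrtSeries : invSqrtSeries * sqrtSeries = 1 := by
  rw [sqrtSeries, invSqrtSeries, ← binomialSeries_add, show (-1 / 2 : ℂ) + 1 / 2 = 0 by norm_num,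
    binomialSeries_zero]

theorem sqrtSeries_ne_zero : sqrtSeries ≠ 0 := by
  intro h
  simpa [h] using invSqrtSeries_mul_sqrtSeries

theorem X_mul_sqrtQuotient : X * sqrtQuotient = sqrtSeries - 1 := by
  ext n
  cases n with
  | zero => simp [sqrtSeries]
  | succ n =>
    rw [coeff_succ_X_mul, sqrtQuotient, coeff_mk, map_sub, sqrtSeries, binomialSeries_coeff]
    simp [coeff_one]

theorem sqrtQuotient_mul : sqrtQuotient * (1 + sqrtSeries) = 1 := by
  apply mul_left_cancel₀ (X_ne_zero : (X : PowerSeries ℂ) ≠ 0)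
  rw [← mul_assoc, X_mul_sqrtQuotient, mul_one]
  linear_combination sqrtSeries_mul_self

theorem constantCoeff_sqrtQuotient : constantCoeff sqrtQuotient = 1 / 2 := by
  rw [← coeff_zero_eq_constantCoeff_apply, sqrtQuotient, coeff_mk, zero_add,
    Ring.choose_one_right]

theorem two_mul_sqrtSeries_mul_derivative :
    2 * (sqrtSeries * derivative ℂ sqrtSeries) = 1 := by
  have h := congrArg (derivative ℂ) sqrtSeries_mul_self
  rw [Derivation.leibniz, smul_eq_mul, map_add, derivative_X, derivative_one, zero_add] at h
  linear_combination h

/-- The power series `(1 + (1 + z)^(1/2)) / 2`. -/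
def sqrtMean : PowerSeries ℂ := C (1 / 2 : ℂ) * (1 + sqrtSeries)

theorem two_mul_C_half : (2 : PowerSeries ℂ) * C (1 / 2 : ℂ) = 1 := by
  rw [← map_ofNat (C (R := ℂ)) 2, ← map_mul]
  norm_num

theorem two_mul_sqrtQuotient_mul_sqrtMean : (2 * sqrtQuotient) * sqrtMean = 1 := by
  rw [sqrtMean]
  linear_combination (2 * C (1 / 2 : ℂ)) * sqrtQuotient_mul + two_mul_C_half

/-- With `s = (1+z)^(1/2)`, the difference is an odd polynomial in `s` of degree at most `k`. After
division by `s` it is a polynomial in `s^2 = 1 + z`, of degree less than `k/2 ≤ n` in `z`. -/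
theorem coeff_sqrt_pow_sub_pow (k n : ℕ) (h : k ≤ 2 * n) :
    coeff n (invSqrtSeries * ((1 + sqrtSeries) ^ k - (1 - sqrtSeries) ^ k)) = 0 := by
  induction k using Nat.strong_induction_on generalizing n with
  | _ k ih =>
    match k with
    | 0 => simp
    | 1 =>
      have : invSqrtSeries * ((1 + sqrtSeries) ^ 1 - (1 - sqrtSeries) ^ 1) = C (2 : ℂ) := by
        rw [map_ofNat]
        linear_combination 2 * invSqrtSeries_mul_sqrtSeries
      rw [this, coeff_C, if_neg (by omega)]
    | k + 2 =>
      obtain ⟨n, rfl⟩ : ∃ n', n = n' + 1 := ⟨n - 1, by omega⟩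
      -- Both `1 + s` and `1 - s` are roots of `x^2 = 2x + z`, which gives a two-term recursion in
      -- the exponent.
      have : invSqrtSeries * ((1 + sqrtSeries) ^ (k + 2) - (1 - sqrtSeries) ^ (k + 2)) =
          C (2 : ℂ) * (invSqrtSeries * ((1 + sqrtSeries) ^ (k + 1) - (1 - sqrtSeries) ^ (k + 1))) +
          X * (invSqrtSeries * ((1 + sqrtSeries) ^ k - (1 - sqrtSeries) ^ k)) := by
        rw [map_ofNat]
        linear_combination invSqrtSeries * ((1 + sqrtSeries) ^ k - (1 - sqrtSeries) ^ k) *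
          sqrtSeries_mul_self
      rw [this, map_add, coeff_C_mul, coeff_succ_X_mul, ih (k + 1) (by omega) (n + 1) (by omega),
        ih k (by omega) n (by omega)]
      simp

/-- By `coeff_sqrt_pow_sub_pow`, `1 + s` may be replaced by `1 - s` in this coefficient. Now `(1 -
s)^(2m)` starts with `(z/2)^(2m)`, and the mean contributes another `2^(-2m)`. -/
theorem coeff_invSqrtSeries_mul_sqrtMean_pow (m : ℕ) :
    coeff (2 * m) (invSqrtSeries * sqrtMean ^ (2 * m)) = (1 / 16) ^ m := by
  have h1 := coeff_sqrt_pow_sub_pow (2 * m) (2 * m) (by omega)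
  have h2 : (1 - sqrtSeries) ^ (2 * m) = X ^ (2 * m) * sqrtQuotient ^ (2 * m) := by
    rw [← mul_pow, X_mul_sqrtQuotient, pow_mul, pow_mul]
    congr 1
    ring
  have h3 : constantCoeff invSqrtSeries = 1 := binomialSeries_constantCoeff _
  rw [mul_sub, map_sub, sub_eq_zero, h2, mul_left_comm, coeff_X_pow_mul', if_pos le_rfl,
    Nat.sub_self, coeff_zero_eq_constantCoeff_apply, map_mul constantCoeff, map_pow constantCoeff,
    constantCoeff_sqrtQuotient, h3] at h1
  rw [sqrtMean, mul_pow, mul_left_comm, ← map_pow, coeff_C_mul, h1, one_mul, ← mul_pow, pow_mul]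
  norm_num

theorem derivative_pow_of_mul_eq_one {g g' : PowerSeries ℂ} (h : g * g' = 1) (k : ℕ) :
    derivative ℂ (g ^ k) = k * (derivative ℂ g * g' * g ^ k) := by
  induction k with
  | zero => simp
  | succ k ih =>
    rw [pow_succ, Derivation.leibniz, ih, smul_eq_mul, smul_eq_mul]
    push_cast
    linear_combination (-(derivative ℂ g) * g ^ k) * h

/-- The solution of the differential equation
`(1 + z)^(1/2) f' = (m ((1 + z)^(1/2) - 1) / z - 2 n ((1 + z)^(1/2))') f`. -/
theorem one_add_X_pow_mul_eq (m n : ℕ) (f : PowerSeries ℂ)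
    (hf : sqrtSeries * derivative ℂ f =
      (m * sqrtQuotient - 2 * n * derivative ℂ sqrtSeries) * f) :
    (1 + X) ^ n * f = C (constantCoeff f) * sqrtMean ^ (2 * m) := by
  have hg := two_mul_sqrtQuotient_mul_sqrtMean
  have h1 : (1 + X : PowerSeries ℂ) ^ n = sqrtSeries ^ (2 * n) := by
    rw [pow_mul, pow_two, sqrtSeries_mul_self]
  -- Here `2 * sqrtQuotient` is the inverse of the mean `(1+s)/2`. Since `s' = 1/(2s)`, the
  -- logarithmic derivative of the mean to the power `2m` is `m/s` times `sqrtQuotient`, so the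
  -- equation says that this product is constant.
  have h2 : derivative ℂ (sqrtSeries ^ (2 * n) * f * (2 * sqrtQuotient) ^ (2 * m)) = 0 := by
    have hd : derivative ℂ (2 * sqrtQuotient) * sqrtMean +
        (2 * sqrtQuotient) * (C (1 / 2 : ℂ) * derivative ℂ sqrtSeries) = 0 := by
      have h := congrArg (derivative ℂ) hg
      rw [Derivation.leibniz, derivative_one, smul_eq_mul, smul_eq_mul] at h
      have h' : derivative ℂ sqrtMean = C (1 / 2 : ℂ) * derivative ℂ sqrtSeries := by
        rw [sqrtMean, Derivation.leibniz, derivative_C, map_add, derivative_one]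
        simp
      rw [h'] at h
      linear_combination h
    apply mul_left_cancel₀ sqrtSeries_ne_zero
    rw [mul_zero, Derivation.leibniz, Derivation.leibniz, derivative_pow_of_mul_eq_one hg,
      derivative_pow_of_mul_eq_one (g' := invSqrtSeries)
        (by rw [mul_comm, invSqrtSeries_mul_sqrtSeries])]
    simp only [smul_eq_mul]
    push_cast
    set A := sqrtSeries ^ (2 * n)
    set D := (2 * sqrtQuotient) ^ (2 * m)
    linear_combination (A * D) * hf +
      (2 * n * derivative ℂ sqrtSeries * A * f * D) * invSqrtSeries_mul_sqrtSeries +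
      (2 * m * sqrtSeries * A * f * D) * hd -
      (2 * m * sqrtQuotient * (sqrtSeries * derivative ℂ sqrtSeries) * A * f * D) *
        two_mul_C_half -
      (m * sqrtQuotient * A * f * D) * two_mul_sqrtSeries_mul_derivative
  have h3 : sqrtSeries ^ (2 * n) * f * (2 * sqrtQuotient) ^ (2 * m) = C (constantCoeff f) := by
    apply derivative.ext
    · rw [h2, derivative_C]
    · simp only [map_mul, map_pow, constantCoeff_sqrtQuotient, sqrtSeries,
        binomialSeries_constantCoeff, constantCoeff_C, map_ofNat]
      norm_num
  rw [h1, ← h3, mul_assoc, ← mul_pow, hg, one_pow, mul_one]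

end SquareRoot

/-! ### The differential equation for Schur series and the relation between `ι(ab)` and `ι(θ(a)b)`.
-/

section Relations

open PowerSeries Finset.HasAntidiagonal

theorem sum_antidiagonal_assoc {M : Type*} [AddCommMonoid M] (n : ℕ) (f : ℕ → ℕ → ℕ → M) :
    ∑ x ∈ antidiagonal n, ∑ y ∈ antidiagonal x.2, f x.1 y.1 y.2 =
      ∑ x ∈ antidiagonal n, ∑ y ∈ antidiagonal x.1, f y.1 y.2 x.2 := by
  rw [Finset.sum_sigma', Finset.sum_sigma']
  refine Finset.sum_bij' (fun x _ => ⟨(x.1.1 + x.2.1, x.2.2), (x.1.1, x.2.1)⟩)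
    (fun x _ => ⟨(x.2.1, x.2.2 + x.1.2), (x.2.2, x.1.2)⟩) ?_ ?_ ?_ ?_ ?_
  all_goals
    rintro ⟨⟨a, b⟩, ⟨c, d⟩⟩ h
    simp only [Finset.mem_sigma, mem_antidiagonal] at h ⊢
  · exact ⟨by omega, trivial⟩
  · exact ⟨by omega, trivial⟩
  · rw [h.2]
  · rw [h.2]

variable {L : Type*} [AddCommGroup L] {Λ : EvenLattice L} {G : Type*} [Group G]
  (E : CentralExtension Λ G) (θ : G ≃* G) (hθ : ∀ a, bar E (θ a) = - bar E a)

/-- The series `∑_k ℓ(S_k ⊗ ι(c)) z^k`, where `∑_k S_k z^k = exp(∑_{n > 0} ā(-n) z^n / n)`. -/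
def schurSeries (ℓ : VL E →ₗ[ℂ] ℂ) (a c : G) : PowerSeries ℂ :=
  mk fun k => ℓ (schur (cbar E a) k ⊗ₜ tw E c)

/-- The zero mode gives `⟨ā, ā⟩ + ⟨ā, b̄⟩`. Its first part is grouped with the modes `i > 0`, so
that the terms in `⟨ā, ā⟩` form one uniform family. -/
theorem annihilation_schur (a b : G) (k i : ℕ) :
    annihilation E (cbar E a) (schur (cbar E a) k ⊗ₜ tw E (a * b)) i =
      (if i ≤ k then (Λ.form (bar E a) (bar E a) : ℂ) •
        (schur (cbar E a) (k - i) ⊗ₜ[ℂ] tw E (a * b)) else 0) +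
      (if i = 0 then (Λ.form (bar E a) (bar E b) : ℂ) •
        (schur (cbar E a) k ⊗ₜ[ℂ] tw E (a * b)) else 0) := by
  rw [annihilation_tmul]
  cases i with
  | zero =>
    rw [annihilationFock_zero_apply, cform_tmul, bar_mul, map_add]
    simp [add_smul]
  | succ i =>
    rw [annihilationFock_schur, cform_tmul]
    split_ifs <;> simp_all [TensorProduct.smul_tmul']

theorem exists_form_self_eq (a : G) : ∃ n : ℕ, Λ.form (bar E a) (bar E a) = 2 * n := by
  obtain ⟨r, hr⟩ := Λ.even (bar E a)
  have h0 : 0 ≤ Λ.form (bar E a) (bar E a) := by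
    by_cases h : bar E a = 0
    · simp [h]
    · exact (Λ.pos _ h).le
  exact ⟨r.toNat, by omega⟩

theorem iota_eq_or_eq_neg {a b : G} (h : bar E a = bar E b) :
    iota E a = iota E b ∨ iota E a = - iota E b := by
  have h1 : E.proj (a * b⁻¹) = 1 := by
    have : E.proj a = E.proj b := h
    rw [map_mul, map_inv, this, mul_inv_cancel]
  rcases (E.ker _).1 h1 with h2 | h2
  · left
    rw [mul_inv_eq_one.1 h2]
  · right
    rw [mul_inv_eq_iff_eq_mul.1 h2, iota, tw_neg, TensorProduct.tmul_neg, iota]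

variable [Module.Free ℤ L] [Module.Finite ℤ L]

/-- Apply `ℓ` to the Heisenberg relations with `h = ā` and `v = S_k ι(ab)` and sum over `p + k`
fixed. The creation modes assemble to `(1+z)^(1/2)` times the derivative of the series, because
`exp(∑ ā(-n) z^n / n)` has logarithmic derivative `∑ ā(-n-1) z^n`. The other modes act on `S_k` by
scalars and a shift. -/
theorem sqrtSeries_mul_derivative_schurSeries (ℓ : VL E →ₗ[ℂ] ℂ)
    (hℓ : ∀ x ∈ zhuO E θ hθ, ℓ x = 0) (a b : G) :
    sqrtSeries * derivative ℂ (schurSeries E ℓ a (a * b)) =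
      -(C (Λ.form (bar E a) (bar E b) : ℂ) * sqrtQuotient +
        C (Λ.form (bar E a) (bar E a) : ℂ) * derivative ℂ sqrtSeries) *
          schurSeries E ℓ a (a * b) := by
  set g := schurSeries E ℓ a (a * b) with hg
  have hgk : ∀ k, coeff k g = ℓ (schur (cbar E a) k ⊗ₜ tw E (a * b)) := fun k => by
    rw [hg, schurSeries, coeff_mk]
  have hd : ∀ r, coeff r (derivative ℂ g) = ∑ y ∈ antidiagonal r,
      ℓ (creation y.1 (cbar E a) • (schur (cbar E a) y.2 ⊗ₜ[ℂ] tw E (a * b))) := by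
    intro r
    rw [coeff_derivative, hgk, mul_comm, ← smul_eq_mul, ← map_smul, TensorProduct.smul_tmul',
      succ_smul_schur_succ, TensorProduct.sum_tmul, map_sum]
    rfl
  have hrel : ∀ p k, ∑ y ∈ antidiagonal p, Ring.choose (1 / 2 : ℂ) y.1 *
      ℓ (creation y.2 (cbar E a) • (schur (cbar E a) k ⊗ₜ[ℂ] tw E (a * b))) =
      -((Λ.form (bar E a) (bar E b) : ℂ) * (Ring.choose (1 / 2 : ℂ) (p + 1) * coeff k g) +
        (Λ.form (bar E a) (bar E a) : ℂ) * ∑ y ∈ antidiagonal k,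
          Ring.choose (1 / 2 : ℂ) (p + y.1 + 1) * coeff y.2 g) := by
    intro p k
    have h1 := hℓ _ (heisenberg_relation E θ hθ (cbar E a) p
      (schur (cbar E a) k ⊗ₜ tw E (a * b)) (k + 1) (fun j hj => by
        rw [annihilation_schur, if_neg (by omega), if_neg (by omega), add_zero]))
    rw [map_add, map_sum, map_sum] at h1
    rw [Finset.Nat.sum_antidiagonal_eq_sum_range_succ (fun i j => Ring.choose (1 / 2 : ℂ) i *
      ℓ (creation j (cbar E a) • (schur (cbar E a) k ⊗ₜ[ℂ] tw E (a * b)))),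
      Finset.Nat.sum_antidiagonal_eq_sum_range_succ (fun i j =>
        Ring.choose (1 / 2 : ℂ) (p + i + 1) * coeff j g), eq_neg_iff_add_eq_zero, ← h1]
    congr 1
    · simp
    · simp only [annihilation_schur, map_smul, smul_add, map_add, Finset.sum_add_distrib]
      rw [add_comm]
      congr 1
      · rw [Finset.mul_sum]
        refine Finset.sum_congr rfl fun i hi => ?_
        rw [Finset.mem_range] at hi
        rw [if_pos (by omega), map_smul, hgk, smul_eq_mul, smul_eq_mul,
          show p + i + 1 = p + 1 + i by ring]
        ring
      · rw [Finset.sum_eq_single_of_mem 0 (by simp)]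
        · rw [if_pos rfl, map_smul, hgk, smul_eq_mul, smul_eq_mul, add_zero]
          ring
        · intro i _ hi
          rw [if_neg hi, map_zero, smul_zero]
  ext q
  rw [coeff_mul]
  simp only [hd, sqrtSeries, binomialSeries_coeff, smul_eq_mul, mul_one, Finset.mul_sum]
  rw [sum_antidiagonal_assoc q (fun j n k => Ring.choose (1 / 2 : ℂ) j *
    ℓ (creation n (cbar E a) • (schur (cbar E a) k ⊗ₜ[ℂ] tw E (a * b))))]
  simp only [hrel]
  rw [Finset.sum_neg_distrib, neg_mul, map_neg, add_mul, map_add, mul_assoc, mul_assoc,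
    coeff_C_mul, coeff_C_mul, coeff_mul, coeff_mul, Finset.sum_add_distrib, ← Finset.mul_sum,
    ← Finset.mul_sum,
    sum_antidiagonal_assoc q (fun p i k => Ring.choose (1 / 2 : ℂ) (p + i + 1) * coeff k g)]
  congr 3
  · simp [sqrtQuotient]
  -- There are `x + 1` pairs `(p, i)` with `p + i = x`, all with the same coefficient `binom(1/2,
  -- x+1)`; the count turns it into a coefficient of the derivative of `(1+z)^(1/2)`.
  · refine Finset.sum_congr rfl fun x _ => ?_
    rw [Finset.sum_congr rfl (g := fun _ => Ring.choose (1 / 2 : ℂ) (x.1 + 1) * coeff x.2 g)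
      (fun y hy => by rw [mem_antidiagonal.1 hy]), Finset.sum_const, Finset.Nat.card_antidiagonal,
      coeff_derivative, binomialSeries_coeff, nsmul_eq_mul]
    push_cast
    simp only [smul_eq_mul]
    ring

/-- The relation of `residue_mem_zhuO` for the odd vector `ι(a) - ι(θa)`, with pole order `m + 1`
adjusted so that `Y(ι(a), z)ι(b) = z^m (ι(ab) + ⋯)` contributes only its leading term. -/
theorem iota_sub_smul_iota_mem_zhuO (hθ2 : ∀ a, θ (θ a) = a) (a b : G) (m : ℕ)
    (hm : Λ.form (bar E a) (bar E b) = m) :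
    iota E (a * b) - ((1 / 16 : ℂ) ^ m) • iota E (θ a * b) ∈ zhuO E θ hθ := by
  by_contra hc
  -- A separating functional turns congruences modulo `O` into equations between scalar power
  -- series.
  obtain ⟨ℓ, hne, hle⟩ := Submodule.exists_le_ker_of_notMem hc
  apply hne
  have hℓ : ∀ x ∈ zhuO E θ hθ, ℓ x = 0 := fun x hx => hle hx
  obtain ⟨n, hn⟩ := exists_form_self_eq E a
  have hn' : Λ.form (bar E (θ a)) (bar E (θ a)) = 2 * n := by simp [hθ, hn]
  have hm' : Λ.form (bar E (θ a)) (bar E b) = -m := by simp [hθ, hm]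
  have h1 := hℓ _ (residue_mem_zhuO E θ hθ m n (iota E a - iota E (θ a)) (iota E b)
    (by simp [iota, thetaMap_tmul, hθ2])
    (Submodule.sub_mem _ (iota_mem_weightSpace E a n hn) (iota_mem_weightSpace E (θ a) n hn')))
  rw [map_sub, LinearMap.sub_apply, residue_sub, residue_Y_iota E _ a b m 0 (by rw [hm]; simp),
    residue_Y_iota E _ (θ a) b m (2 * m) (by rw [hm']; push_cast; ring), map_sub, map_sum,
    map_sum] at h1
  -- The series belongs to `θa`, whose pairing with `b̄` is `-m`; this produces the positive
  -- exponent `2m`.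
  have h2 := one_add_X_pow_mul_eq m n (schurSeries E ℓ (θ a) (θ a * b)) (by
    rw [sqrtSeries_mul_derivative_schurSeries E θ hθ ℓ hℓ, hm', hn']
    push_cast
    simp only [map_neg, map_mul, map_natCast, map_ofNat]
    ring)
  have h3 : ∑ j ∈ Finset.range (2 * m + 1), ℓ (Ring.choose ((n : ℤ) - 1 / 2 : ℂ) j •
      (schur (cbar E (θ a)) (2 * m - j) ⊗ₜ[ℂ] tw E (θ a * b))) =
      coeff (2 * m) (PowerSeries.binomialSeries ℂ ((n : ℤ) - 1 / 2 : ℂ) *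
        schurSeries E ℓ (θ a) (θ a * b)) := by
    rw [coeff_mul, Finset.Nat.sum_antidiagonal_eq_sum_range_succ (fun i j =>
      coeff i (PowerSeries.binomialSeries ℂ ((n : ℤ) - 1 / 2 : ℂ)) *
        coeff j (schurSeries E ℓ (θ a) (θ a * b)))]
    simp [schurSeries]
  have h4 : PowerSeries.binomialSeries ℂ ((n : ℤ) - 1 / 2 : ℂ) = invSqrtSeries * (1 + X) ^ n := by
    rw [← binomialSeries_nat (R := ℂ), invSqrtSeries, ← binomialSeries_add]
    congr 1
    push_cast
    ring
  have h5 : constantCoeff (schurSeries E ℓ (θ a) (θ a * b)) = ℓ (iota E (θ a * b)) := by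
    rw [← coeff_zero_eq_constantCoeff_apply, schurSeries, coeff_mk, schur_zero, iota]
  rw [h3, h4, mul_assoc, h2, mul_left_comm, coeff_C_mul, coeff_invSqrtSeries_mul_sqrtMean_pow,
    h5] at h1
  rw [map_sub, map_smul, smul_eq_mul, ← h1]
  simp [schur_zero, iota, mul_comm]

/-- For a negative pairing the roles of `a` and `θa` are exchanged, and the constant is inverted,
which is possible as `16^(-m) ≠ 0`. -/
theorem exists_iota_sub_smul_iota_mem_zhuO (hθ2 : ∀ a, θ (θ a) = a) (a b : G) :
    ∃ c : ℂ, iota E (a * b) - c • iota E (θ a * b) ∈ zhuO E θ hθ := by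
  rcases le_total 0 (Λ.form (bar E a) (bar E b)) with h | h
  · obtain ⟨m, hm⟩ := Int.eq_ofNat_of_zero_le h
    exact ⟨_, iota_sub_smul_iota_mem_zhuO E θ hθ hθ2 a b m hm⟩
  · obtain ⟨m, hm⟩ := Int.eq_ofNat_of_zero_le (neg_nonneg.2 h)
    have h1 := iota_sub_smul_iota_mem_zhuO E θ hθ hθ2 (θ a) b m (by simp [hθ, hm])
    rw [hθ2] at h1
    refine ⟨((1 / 16 : ℂ) ^ m)⁻¹, ?_⟩
    have h2 := Submodule.smul_mem _ (-((1 / 16 : ℂ) ^ m)⁻¹) h1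
    have h0 : ((1 / 16 : ℂ) ^ m) ≠ 0 := pow_ne_zero _ (by norm_num)
    rw [smul_sub, smul_smul, neg_mul, inv_mul_cancel₀ h0] at h2
    convert h2 using 1
    module

end Relations

end LatticeVOA

end

/-! ### Passage to representatives of `L/2L`. -/

theorem proposition3p11 {L : Type*} [AddCommGroup L] [Module.Free ℤ L] [Module.Finite ℤ L]
    (Λ : EvenLattice L) {G : Type*} [Group G] (E : CentralExtension Λ G)
    (θ : G ≃* G) (hθ : ∀ a, LatticeVOA.bar E (θ a) = - LatticeVOA.bar E a)
    (hθ2 : ∀ a, θ (θ a) = a)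
    (e : L → G) (he : ∀ α, LatticeVOA.bar E (e α) = α)
    (β : L ⧸ (zsmulAddGroupHom (2 : ℤ) : L →+ L).range → L)
    (hβ : ∀ i, QuotientAddGroup.mk (β i) = i) :
    Submodule.span ℂ (Set.range fun i =>
      (TwistedZhu.O (LatticeVOA.Y E) (LatticeVOA.omega E) (LatticeVOA.thetaMap E θ hθ) 2).mkQ
        (LatticeVOA.iota E (e (β i)))) = ⊤ ∧
    Module.rank ℂ
        (TwistedZhu.A (LatticeVOA.Y E) (LatticeVOA.omega E) (LatticeVOA.thetaMap E θ hθ) 2) ≤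
      (Nat.card (L ⧸ (zsmulAddGroupHom (2 : ℤ) : L →+ L).range) : Cardinal) := by
  have hspan : Submodule.span ℂ (Set.range fun i =>
      (LatticeVOA.zhuO E θ hθ).mkQ (LatticeVOA.iota E (e (β i)))) = ⊤ := by
    rw [← top_le_iff, ← Submodule.range_mkQ (LatticeVOA.zhuO E θ hθ), LinearMap.range_eq_map,
      ← LatticeVOA.zhuO_sup_span_iota E θ hθ, Submodule.map_sup, Submodule.mkQ_map_self,
      bot_sup_eq, Submodule.map_span, Submodule.span_le]
    rintro _ ⟨_, ⟨c, rfl⟩, rfl⟩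
    set i : L ⧸ (zsmulAddGroupHom (2 : ℤ) : L →+ L).range :=
      QuotientAddGroup.mk (LatticeVOA.bar E c)
    -- With `a = e γ` and `b = a⁻¹c` one has `ab = c`, while `θ(a)b` lies over `c̄ - 2γ = β i`. It
    -- thus agrees with `e (β i)` up to the central sign.
    obtain ⟨γ, hγ⟩ : ∃ γ : L, (2 : ℤ) • γ = - β i + LatticeVOA.bar E c := by
      obtain ⟨γ, hγ⟩ := QuotientAddGroup.eq.1 (hβ i)
      exact ⟨γ, by simpa using hγ⟩
    obtain ⟨k, hk⟩ := LatticeVOA.exists_iota_sub_smul_iota_mem_zhuO E θ hθ hθ2 (e γ) ((e γ)⁻¹ * c)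
    rw [mul_inv_cancel_left] at hk
    have hbar : LatticeVOA.bar E (θ (e γ) * ((e γ)⁻¹ * c)) = LatticeVOA.bar E (e (β i)) := by
      rw [LatticeVOA.bar_mul, LatticeVOA.bar_mul, LatticeVOA.bar_inv, hθ, he, he,
        eq_neg_add_iff_add_eq.1 hγ |>.symm]
      abel
    have h1 : (LatticeVOA.zhuO E θ hθ).mkQ (LatticeVOA.iota E c) =
        k • (LatticeVOA.zhuO E θ hθ).mkQ (LatticeVOA.iota E (θ (e γ) * ((e γ)⁻¹ * c))) := by
      rw [← sub_eq_zero, ← map_smul, ← map_sub, Submodule.mkQ_apply, Submodule.Quotient.mk_eq_zero]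
      exact hk
    have h2 : (LatticeVOA.zhuO E θ hθ).mkQ (LatticeVOA.iota E (e (β i))) ∈
        Submodule.span ℂ (Set.range fun i =>
          (LatticeVOA.zhuO E θ hθ).mkQ (LatticeVOA.iota E (e (β i)))) :=
      Submodule.subset_span ⟨i, rfl⟩
    rw [SetLike.mem_coe, h1]
    refine Submodule.smul_mem _ _ ?_
    rcases LatticeVOA.iota_eq_or_eq_neg E hbar with h | h
    · rw [h]
      exact h2
    · rw [h, map_neg]
      exact Submodule.neg_mem _ h2
  refine ⟨hspan, ?_⟩
  -- Finiteness of `L/2L` is needed because `Nat.card` of an infinite type is `0`, which would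
  -- falsify the bound.
  have hfin : Finite (L ⧸ (zsmulAddGroupHom (2 : ℤ) : L →+ L).range) := by
    have : Module.Finite ℤ (L ⧸ (zsmulAddGroupHom (2 : ℤ) : L →+ L).range) :=
      Module.Finite.of_surjective
        (QuotientAddGroup.mk' (zsmulAddGroupHom (2 : ℤ) : L →+ L).range).toIntLinearMap
        (QuotientAddGroup.mk'_surjective _)
    apply Module.finite_of_fg_torsion
    intro x
    obtain ⟨y, rfl⟩ := QuotientAddGroup.mk'_surjective _ x
    refine ⟨⟨2, by simp⟩, ?_⟩
    change (2 : ℤ) • QuotientAddGroup.mk' (zsmulAddGroupHom (2 : ℤ) : L →+ L).range y = 0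
    rw [← map_zsmul]
    exact (QuotientAddGroup.eq_zero_iff _).2 ⟨y, rfl⟩
  have hrank := rank_span_le (R := ℂ) (Set.range fun i =>
    (LatticeVOA.zhuO E θ hθ).mkQ (LatticeVOA.iota E (e (β i))))
  rw [hspan, rank_top] at hrank
  refine hrank.trans ?_
  rw [← Nat.cast_card]
  exact_mod_cast Finite.card_range_le _
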